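/- **Setting.** Let $n$ be a natural number, $A=(a_{ij})_{0<i,j<n}$ the Cartan matrix of type $A_{n-1}$, $q\in\mathbb C$ with $q\ne0$, $q\neq q^{-1}$, and let $g=(g_{ij})_{0<i,j<n}$ be meromorphic functions on $\mathbb C^\times=\mathbb C\setminus\{0\}$, not identically zero, with $g_{ij}(z)=g_{ji}(z^{-1})^{-1}$, and $g_{ij}=1$ whenever $a_{ij}=0$. Let $\delta:\mathbb C^\times\to\mathbb C$ be supported at $1$ (i.e. $\delta(u)=0$ for $u\neq1$). Put $$h_{ij}(u,v)=\frac{(g_{ii}(u/v)+1)(g_{ij}(u)g_{ij}(v)+1)}{g_{ij}(v)+g_{ii}(u/v)\,g_{ij}(u)} .$$ The algebra $U_q(g,\mathfrak{sl}_n)$ is a functional algebra: the spectral parameters are points of $\mathbb C^\times$, and the central element $q^{c/2}$ takes its values in a subgroup $\Gamma\subseteq\mathbb C^\times$, which is arbitrary. For $t\in\Gamma$ let $U_t$, the specialisation of $U_q(g,\mathfrak{sl}_n)$ at $q^{c/2}=t$, be the unital associative $\mathbb C$-algebra generated by $x_i^\pm(z)$ and invertible $\varphi_i(z)$, $\psi_i(z)$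 ($0<i<n$, $z\in\mathbb C^\times$), with the relations (where $q^{c/2}=t$) \begin{align*} &\varphi_i(z)\varphi_j(w)=\varphi_j(w)\varphi_i(z),\qquad \psi_i(z)\psi_j(w)=\psi_j(w)\psi_i(z),\\ &\varphi_i(z)\psi_j(w)\varphi_i(z)^{-1}\psi_j(w)^{-1}=\frac{g_{ij}(\frac zw q^{-c})}{g_{ij}(\frac zw q^{c})},\\ &\varphi_i(z)x_j^\pm(w)\varphi_i(z)^{-1}=g_{ij}(\tfrac zw q^{\mp c/2})^{\pm1}x_j^\pm(w),\\ &\psi_i(z)x_j^\pm(w)\psi_i(z)^{-1}=g_{ji}(\tfrac wz q^{\mp c/2})^{\mp1}x_j^\pm(w),\\ &[x_i^+(z),x_j^-(w)]=\frac{\delta_{ij}}{q-q^{-1}}\left\{\delta(\tfrac zwq^{-c})\psi_i(wq^{c/2})-\delta(\tfrac zwq^{c})\varphi_i(zq^{c/2})\right\},\\ &x_i^\pm(z)x_j^\pm(w)=g_{ij}(\tfrac zw)^{\pm1}x_j^\pm(w)x_i^\pm(z),\qquad [x_i^\pm(z),x_j^\pm(w)]=0\ \text{ if }a_{ij}=0,\\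 &x_i^\pm(z_1)x_i^\pm(z_2)x_j^\pm(w)-h_{ij}(\tfrac{z_1}w,\tfrac{z_2}w)x_i^\pm(z_1)x_j^\pm(w)x_i^\pm(z_2)+x_j^\pm(w)x_i^\pm(z_1)x_i^\pm(z_2)\\ &\qquad+\{z_1\leftrightarrow z_2\}=0\ \text{ if }a_{ij}=-1 . \end{align*} Each relation is imposed only where its structure functions are regular, where a point is called regular for $g_{ij}$ if it is neither a pole nor a zero of it. Precisely: the relations between $\varphi_i(z)$ and $\psi_j(w)$, between $\varphi_i(z)$ and $x_j^-(w)$, and between $x_i^+(z)$ and $x_j^-(w)$ are imposed when every point of the coset $\frac zw\Gamma$ is regular for $g_{ij}$; the relation between $\psi_i(z)$ and $x_j^+(w)$ when every point of $\frac wz\Gamma$ is regular for $g_{ji}$; the relations $\varphi_ix_j^+$, $\psi_ix_j^-$ and $x_i^\pm x_j^\pm$ when the displayed argument of the structure function is regular for it; the cubic relations when $z_1/z_2$ is regular for $g_{ii}$, $z_1/w$ and $z_2/w$ are regular for $g_{ij}$, and the denominator of $h_{ij}(\frac{z_1}w,\frac{z_2}w)$ is nonzero. The other relations are imposed at all points.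 **Theorem.** $U_q(g,\mathfrak{sl}_n)$ carries a unique (functional) Hopf algebra structure with the coproduct \begin{align*} &\Delta(q^c)=q^c\otimes q^c,\\ &\Delta(x_i^+(z))=x_i^+(z)\otimes1+\varphi_i(zq^{c_1/2})\otimes x_i^+(zq^{c_1}),\\ &\Delta(x_i^-(z))=1\otimes x_i^-(z)+x_i^-(zq^{c_2})\otimes\psi_i(zq^{c_2/2}),\\ &\Delta(\varphi_i(z))=\varphi_i(zq^{-c_2/2})\otimes\varphi_i(zq^{c_1/2}),\qquad \Delta(\psi_i(z))=\psi_i(zq^{c_2/2})\otimes\psi_i(zq^{-c_1/2}), \end{align*} where $c_1=c\otimes1$, $c_2=1\otimes c$, the counit $$\varepsilon(q^c)=1,\quad\varepsilon(\varphi_i(z))=\varepsilon(\psi_i(z))=1,\quad\varepsilon(x_i^\pm(z))=0,$$ and the antipode \begin{align*} &a(q^c)=q^{-c},\quad a(x_i^+(z))=-\varphi_i(zq^{-c/2})^{-1}x_i^+(zq^{-c}),\quad a(x_i^-(z))=-x_i^-(zq^{-c})\psi_i(zq^{-c/2})^{-1},\\ &a(\varphi_i(z))=\varphi_i(z)^{-1},\quad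 a(\psi_i(z))=\psi_i(z)^{-1}. \end{align*} That is: there are unique algebra homomorphisms $\Delta:U_{st}\to U_s\otimes U_t$ and $\varepsilon:U_1\to\mathbb C$ and algebra anti-homomorphisms $a:U_t\to U_{t^{-1}}$, for all $s,t\in\Gamma$, which are given by these formulas (with $q^{c_1/2}=s$, $q^{c_2/2}=t$ in those for $\Delta$, and with $q^{c/2}$ on the right-hand sides for $a$ taken in the target algebra) and satisfy, with $M$ the multiplication, $(\Delta\otimes\mathrm{id})\Delta=(\mathrm{id}\otimes\Delta)\Delta$ on every $U_{rst}$, $(\varepsilon\otimes\mathrm{id})\Delta=\mathrm{id}=(\mathrm{id}\otimes\varepsilon)\Delta$ on every $U_t$, and $M(a\otimes\mathrm{id})\Delta=\varepsilon=M(\mathrm{id}\otimes a)\Delta$ on $U_1$ (for $\Delta:U_1\to U_{t^{-1}}\otimes U_t$, respectively $\Delta:U_1\to U_t\otimes U_{t^{-1}}$). -/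

import Mathlib

open scoped TensorProduct

/-! ## Hopf algebras fibred over the value of a group-like central element -/

/-- A Hopf algebra `A` with a central group-like parameter taking values in a group `G`, given by
its specialisations `A a` at the values `a : G` of the parameter (a "Hopf group-coalgebra").
Because the parameter is group-like, the coproduct maps `A (a * b)` to `A a ⊗ A b`, the counit lives
on `A 1`, and the antipode maps `A a` to `A a⁻¹`.  The equations between group elements are passed
as hypotheses, in order that no transport between fibres is needed.  For the trivial group this is a
Hopf algebra in the usual sense. -/
structure HopfGroupCoalgebra (k : Type) [Field k] (G : Type) [Group G]
    (A : G → Type) [∀ a, Ring (A a)] [∀ a, Algebra k (A a)] where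
  /-- the coproduct, a homomorphism of algebras -/
  comul : ∀ {a b c : G}, c = a * b → (A c →ₐ[k] A a ⊗[k] A b)
  /-- the counit, a homomorphism of algebras -/
  counit : A 1 →ₐ[k] k
  /-- the antipode, an anti-homomorphism of algebras -/
  antipode : ∀ {a b : G}, a * b = 1 → (A a →ₐ[k] (A b)ᵐᵒᵖ)
  /-- `(Δ ⊗ id) Δ = (id ⊗ Δ) Δ` -/
  coassoc : ∀ {a b c ab bc abc : G} (h₁ : ab = a * b) (h₂ : abc = ab * c)
    (h₃ : bc = b * c) (h₄ : abc = a * bc) (y : A abc),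
    Algebra.TensorProduct.assoc k k k (A a) (A b) (A c)
        (Algebra.TensorProduct.map (comul h₁) (AlgHom.id k (A c)) (comul h₂ y)) =
      Algebra.TensorProduct.map (AlgHom.id k (A a)) (comul h₃) (comul h₄ y)
  /-- `(ε ⊗ id) Δ = id` -/
  counit_left : ∀ {a : G} (h : a = 1 * a) (y : A a),
    Algebra.TensorProduct.lid k (A a)
      (Algebra.TensorProduct.map counit (AlgHom.id k (A a)) (comul h y)) = y
  /-- `(id ⊗ ε) Δ = id` -/
  counit_right : ∀ {a : G} (h : a = a * 1) (y : A a),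
    Algebra.TensorProduct.rid k k (A a)
      (Algebra.TensorProduct.map (AlgHom.id k (A a)) counit (comul h y)) = y
  /-- `M (S ⊗ id) Δ = ε` -/
  antipode_left : ∀ {a b : G} (h : a * b = 1) (h' : 1 = a * b) (y : A 1),
    LinearMap.mul' k (A b)
      (TensorProduct.map
        ((MulOpposite.opLinearEquiv k).symm.toLinearMap ∘ₗ (antipode h).toLinearMap)
        LinearMap.id (comul h' y)) = algebraMap k (A b) (counit y)
  /-- `M (id ⊗ S) Δ = ε` -/
  antipode_right : ∀ {a b : G} (h : b * a = 1) (h' : 1 = a * b) (y : A 1),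
    LinearMap.mul' k (A a)
      (TensorProduct.map LinearMap.id
        ((MulOpposite.opLinearEquiv k).symm.toLinearMap ∘ₗ (antipode h).toLinearMap)
        (comul h' y)) = algebraMap k (A a) (counit y)

namespace FunctionalAlgebra

/-! ## Structure functions -/

/-- `(g_ij)`, `0 < i, j < n`, are structure functions of type `A_{n-1}`: meromorphic functions on
`ℂ ∖ {0}`, not identically zero, such that `g_ij(z) = g_ji(z⁻¹)⁻¹`, and `g_ij = 1` if `a_ij = 0`.

The functions are in normal form (removable singularities removed, value `0` at the poles).
Hence, for `z ≠ 0`, the inequality `g i j z ≠ 0` says exactly that `z` is neither a pole nor a zero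
of `g_ij`; at a pole or zero both sides of `inversion` are `0`. -/
structure IsStructureFunctions (n : ℕ) (g : Fin (n - 1) → Fin (n - 1) → ℂ → ℂ) : Prop where
  meromorphic : ∀ i j, MeromorphicNFOn (g i j) {0}ᶜ
  not_zero : ∀ i j, ∃ z, z ≠ 0 ∧ g i j z ≠ 0
  inversion : ∀ i j z, z ≠ 0 → g i j z = (g j i z⁻¹)⁻¹
  commuting : ∀ i j, CartanMatrix.A (n - 1) i j = 0 → ∀ z, z ≠ 0 → g i j z = 1

section

variable {n : ℕ} (g : Fin (n - 1) → Fin (n - 1) → ℂ → ℂ)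

/-- The denominator of `h_ij(u, v)`, where `u = z₁/w` and `v = z₂/w`. -/
noncomputable def hDen (i j : Fin (n - 1)) (u v : ℂ) : ℂ :=
  g i j v + g i i (u / v) * g i j u

/-- `h_ij(u, v)`, where `u = z₁/w` and `v = z₂/w`. -/
noncomputable def h (i j : Fin (n - 1)) (u v : ℂ) : ℂ :=
  (g i i (u / v) + 1) * (g i j u * g i j v + 1) / hDen g i j u v

/-- No point of the coset `u Γ` is a zero or a pole of `g_ij`. -/
def RegularAlong (Γ : Subgroup ℂˣ) (i j : Fin (n - 1)) (u : ℂˣ) : Prop :=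
  ∀ l ∈ Γ, g i j ((u * l : ℂˣ) : ℂ) ≠ 0

end

/-! ## Generators and relations -/

/-- The generators, for `0 < i < n` and a point `z` of `ℂ ∖ {0}`: `x_i^+(z)`, `x_i^-(z)`,
`φ_i(z)`, `φ_i(z)⁻¹`, `ψ_i(z)`, `ψ_i(z)⁻¹`. -/
inductive Gen (n : ℕ) : Type
  | xp (i : Fin (n - 1)) (z : ℂˣ)
  | xm (i : Fin (n - 1)) (z : ℂˣ)
  | phi (i : Fin (n - 1)) (z : ℂˣ)
  | phiInv (i : Fin (n - 1)) (z : ℂˣ)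
  | psi (i : Fin (n - 1)) (z : ℂˣ)
  | psiInv (i : Fin (n - 1)) (z : ℂˣ)

/-- The free algebra on the generators. -/
abbrev Free (n : ℕ) : Type := FreeAlgebra ℂ (Gen n)

namespace Free

variable {n : ℕ}

/-- `x_i^+(z)` in the free algebra -/
def xp (i : Fin (n - 1)) (z : ℂˣ) : Free n := FreeAlgebra.ι ℂ (Gen.xp i z)
/-- `x_i^-(z)` in the free algebra -/
def xm (i : Fin (n - 1)) (z : ℂˣ) : Free n := FreeAlgebra.ι ℂ (Gen.xm i z)
/-- `φ_i(z)` in the free algebra -/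
def phi (i : Fin (n - 1)) (z : ℂˣ) : Free n := FreeAlgebra.ι ℂ (Gen.phi i z)
/-- `φ_i(z)⁻¹` in the free algebra -/
def phiInv (i : Fin (n - 1)) (z : ℂˣ) : Free n := FreeAlgebra.ι ℂ (Gen.phiInv i z)
/-- `ψ_i(z)` in the free algebra -/
def psi (i : Fin (n - 1)) (z : ℂˣ) : Free n := FreeAlgebra.ι ℂ (Gen.psi i z)
/-- `ψ_i(z)⁻¹` in the free algebra -/
def psiInv (i : Fin (n - 1)) (z : ℂˣ) : Free n := FreeAlgebra.ι ℂ (Gen.psiInv i z)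

end Free

open Free in
/-- The defining relations of the specialisation at `q^{c/2} = t`, where `t` belongs to the group
`Γ` of admitted values of `q^{c/2}`.

A relation is imposed at those points where its structure functions are regular (neither zero nor
pole).  For the four relations (between `φ` and `ψ`, `φ` and `x^-`, `ψ` and `x^+`, `x^+` and `x^-`)
in which a coproduct moves the ratio of the two points by values of the parameter, regularity is
required along the whole coset of the ratio modulo `Γ`. -/
inductive Rel {n : ℕ} (g : Fin (n - 1) → Fin (n - 1) → ℂ → ℂ) (q : ℂ) (δ : ℂˣ → ℂ)
    (Γ : Subgroup ℂˣ) (t : ℂˣ) : Free n → Free n → Prop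
  -- `φ_i(z)` and `ψ_i(z)` are invertible
  | phi_mul_inv (i : Fin (n - 1)) (z : ℂˣ) : Rel g q δ Γ t (phi i z * phiInv i z) 1
  | phi_inv_mul (i : Fin (n - 1)) (z : ℂˣ) : Rel g q δ Γ t (phiInv i z * phi i z) 1
  | psi_mul_inv (i : Fin (n - 1)) (z : ℂˣ) : Rel g q δ Γ t (psi i z * psiInv i z) 1
  | psi_inv_mul (i : Fin (n - 1)) (z : ℂˣ) : Rel g q δ Γ t (psiInv i z * psi i z) 1
  -- the Cartan currents
  | phi_phi (i j : Fin (n - 1)) (z w : ℂˣ) :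
      Rel g q δ Γ t (phi i z * phi j w) (phi j w * phi i z)
  | psi_psi (i j : Fin (n - 1)) (z w : ℂˣ) :
      Rel g q δ Γ t (psi i z * psi j w) (psi j w * psi i z)
  | phi_psi (i j : Fin (n - 1)) (z w : ℂˣ) (hr : RegularAlong g Γ i j (z / w)) :
      Rel g q δ Γ t (phi i z * psi j w * phiInv i z * psiInv j w)
        (algebraMap ℂ (Free n)
          (g i j ((z / w * (t ^ 2)⁻¹ : ℂˣ) : ℂ) / g i j ((z / w * t ^ 2 : ℂˣ) : ℂ)))
  -- Cartan currents and `x^±`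
  | phi_xp (i j : Fin (n - 1)) (z w : ℂˣ) (hr : g i j ((z / w * t⁻¹ : ℂˣ) : ℂ) ≠ 0) :
      Rel g q δ Γ t (phi i z * xp j w * phiInv i z)
        (g i j ((z / w * t⁻¹ : ℂˣ) : ℂ) • xp j w)
  | phi_xm (i j : Fin (n - 1)) (z w : ℂˣ) (hr : RegularAlong g Γ i j (z / w)) :
      Rel g q δ Γ t (phi i z * xm j w * phiInv i z)
        ((g i j ((z / w * t : ℂˣ) : ℂ))⁻¹ • xm j w)
  | psi_xp (i j : Fin (n - 1)) (z w : ℂˣ) (hr : RegularAlong g Γ j i (w / z)) :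
      Rel g q δ Γ t (psi i z * xp j w * psiInv i z)
        ((g j i ((w / z * t⁻¹ : ℂˣ) : ℂ))⁻¹ • xp j w)
  | psi_xm (i j : Fin (n - 1)) (z w : ℂˣ) (hr : g j i ((w / z * t : ℂˣ) : ℂ) ≠ 0) :
      Rel g q δ Γ t (psi i z * xm j w * psiInv i z)
        (g j i ((w / z * t : ℂˣ) : ℂ) • xm j w)
  -- `[x_i^+(z), x_j^-(w)]`
  | xp_xm_same (i : Fin (n - 1)) (z w : ℂˣ) (hr : RegularAlong g Γ i i (z / w)) :
      Rel g q δ Γ t (xp i z * xm i w - xm i w * xp i z)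
        ((1 / (q - q⁻¹)) • (δ (z / w * (t ^ 2)⁻¹) • psi i (w * t) -
          δ (z / w * t ^ 2) • phi i (z * t)))
  | xp_xm_ne (i j : Fin (n - 1)) (hij : i ≠ j) (z w : ℂˣ)
      (hr : RegularAlong g Γ i j (z / w)) :
      Rel g q δ Γ t (xp i z * xm j w - xm j w * xp i z) 0
  -- quadratic relations
  | xp_xp (i j : Fin (n - 1)) (z w : ℂˣ) (hr : g i j ((z / w : ℂˣ) : ℂ) ≠ 0) :
      Rel g q δ Γ t (xp i z * xp j w) (g i j ((z / w : ℂˣ) : ℂ) • (xp j w * xp i z))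
  | xm_xm (i j : Fin (n - 1)) (z w : ℂˣ) (hr : g i j ((z / w : ℂˣ) : ℂ) ≠ 0) :
      Rel g q δ Γ t (xm i z * xm j w) ((g i j ((z / w : ℂˣ) : ℂ))⁻¹ • (xm j w * xm i z))
  | xp_comm (i j : Fin (n - 1)) (ha : CartanMatrix.A (n - 1) i j = 0) (z w : ℂˣ) :
      Rel g q δ Γ t (xp i z * xp j w - xp j w * xp i z) 0
  | xm_comm (i j : Fin (n - 1)) (ha : CartanMatrix.A (n - 1) i j = 0) (z w : ℂˣ) :
      Rel g q δ Γ t (xm i z * xm j w - xm j w * xm i z) 0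
  -- cubic relations
  | xp_serre (i j : Fin (n - 1)) (ha : CartanMatrix.A (n - 1) i j = -1) (z₁ z₂ w : ℂˣ)
      (hr : g i i ((z₁ / z₂ : ℂˣ) : ℂ) ≠ 0) (hr₁ : g i j ((z₁ / w : ℂˣ) : ℂ) ≠ 0)
      (hr₂ : g i j ((z₂ / w : ℂˣ) : ℂ) ≠ 0)
      (hd : hDen g i j ((z₁ / w : ℂˣ) : ℂ) ((z₂ / w : ℂˣ) : ℂ) ≠ 0) :
      Rel g q δ Γ t
        ((xp i z₁ * xp i z₂ * xp j w
            - h g i j ((z₁ / w : ℂˣ) : ℂ) ((z₂ / w : ℂˣ) : ℂ) • (xp i z₁ * xp j w * xp i z₂)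
            + xp j w * xp i z₁ * xp i z₂)
          + (xp i z₂ * xp i z₁ * xp j w
            - h g i j ((z₂ / w : ℂˣ) : ℂ) ((z₁ / w : ℂˣ) : ℂ) • (xp i z₂ * xp j w * xp i z₁)
            + xp j w * xp i z₂ * xp i z₁)) 0
  | xm_serre (i j : Fin (n - 1)) (ha : CartanMatrix.A (n - 1) i j = -1) (z₁ z₂ w : ℂˣ)
      (hr : g i i ((z₁ / z₂ : ℂˣ) : ℂ) ≠ 0) (hr₁ : g i j ((z₁ / w : ℂˣ) : ℂ) ≠ 0)
      (hr₂ : g i j ((z₂ / w : ℂˣ) : ℂ) ≠ 0)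
      (hd : hDen g i j ((z₁ / w : ℂˣ) : ℂ) ((z₂ / w : ℂˣ) : ℂ) ≠ 0) :
      Rel g q δ Γ t
        ((xm i z₁ * xm i z₂ * xm j w
            - h g i j ((z₁ / w : ℂˣ) : ℂ) ((z₂ / w : ℂˣ) : ℂ) • (xm i z₁ * xm j w * xm i z₂)
            + xm j w * xm i z₁ * xm i z₂)
          + (xm i z₂ * xm i z₁ * xm j w
            - h g i j ((z₂ / w : ℂˣ) : ℂ) ((z₁ / w : ℂˣ) : ℂ) • (xm i z₂ * xm j w * xm i z₁)
            + xm j w * xm i z₂ * xm i z₁)) 0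

/-- The specialisation of `U_q(g, sl_n)` at `q^{c/2} = t`. -/
def U {n : ℕ} (g : Fin (n - 1) → Fin (n - 1) → ℂ → ℂ) (q : ℂ) (δ : ℂˣ → ℂ)
    (Γ : Subgroup ℂˣ) (t : Γ) : Type :=
  RingQuot (Rel g q δ Γ (t : ℂˣ))

section

variable {n : ℕ} (g : Fin (n - 1) → Fin (n - 1) → ℂ → ℂ) (q : ℂ) (δ : ℂˣ → ℂ)
  (Γ : Subgroup ℂˣ) (t : Γ)

noncomputable instance : Ring (U g q δ Γ t) :=
  inferInstanceAs (Ring (RingQuot (Rel g q δ Γ (t : ℂˣ))))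

noncomputable instance : Algebra ℂ (U g q δ Γ t) :=
  inferInstanceAs (Algebra ℂ (RingQuot (Rel g q δ Γ (t : ℂˣ))))

/-- The quotient map from the free algebra. -/
noncomputable def mk : Free n →ₐ[ℂ] U g q δ Γ t :=
  RingQuot.mkAlgHom ℂ (Rel g q δ Γ (t : ℂˣ))

/-- `q^c` in the specialisation at `q^{c/2} = t`. -/
noncomputable def qc : U g q δ Γ t := algebraMap ℂ (U g q δ Γ t) (((t : ℂˣ) : ℂ) ^ 2)

variable {t}

/-- `x_i^+(z)` -/
noncomputable def xp (i : Fin (n - 1)) (z : ℂˣ) : U g q δ Γ t := mk g q δ Γ t (Free.xp i z)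
/-- `x_i^-(z)` -/
noncomputable def xm (i : Fin (n - 1)) (z : ℂˣ) : U g q δ Γ t := mk g q δ Γ t (Free.xm i z)
/-- `φ_i(z)` -/
noncomputable def phi (i : Fin (n - 1)) (z : ℂˣ) : U g q δ Γ t := mk g q δ Γ t (Free.phi i z)
/-- `φ_i(z)⁻¹` -/
noncomputable def phiInv (i : Fin (n - 1)) (z : ℂˣ) : U g q δ Γ t :=
  mk g q δ Γ t (Free.phiInv i z)
/-- `ψ_i(z)` -/
noncomputable def psi (i : Fin (n - 1)) (z : ℂˣ) : U g q δ Γ t := mk g q δ Γ t (Free.psi i z)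
/-- `ψ_i(z)⁻¹` -/
noncomputable def psiInv (i : Fin (n - 1)) (z : ℂˣ) : U g q δ Γ t :=
  mk g q δ Γ t (Free.psiInv i z)

end

/-! ## The formulas for the Hopf structure

On the tensor product of the specialisations at `a` and `b`, the central elements `q^{c₁/2}`,
`q^{c₂/2}` have the values `a`, `b`. -/

section

variable {n : ℕ} {g : Fin (n - 1) → Fin (n - 1) → ℂ → ℂ} {q : ℂ} {δ : ℂˣ → ℂ}
  {Γ : Subgroup ℂˣ}

/-- The coproduct is given by the Drinfeld formulas. -/
structure ComulFormulas (H : HopfGroupCoalgebra ℂ Γ (U g q δ Γ)) : Prop where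
  on_qc : ∀ {a b c : Γ} (hc : c = a * b),
    H.comul hc (qc g q δ Γ c) = qc g q δ Γ a ⊗ₜ[ℂ] qc g q δ Γ b
  on_xp : ∀ {a b c : Γ} (hc : c = a * b) (i : Fin (n - 1)) (z : ℂˣ),
    H.comul hc (xp g q δ Γ i z) =
      xp g q δ Γ i z ⊗ₜ[ℂ] 1 + phi g q δ Γ i (z * a) ⊗ₜ[ℂ] xp g q δ Γ i (z * (a : ℂˣ) ^ 2)
  on_xm : ∀ {a b c : Γ} (hc : c = a * b) (i : Fin (n - 1)) (z : ℂˣ),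
    H.comul hc (xm g q δ Γ i z) =
      1 ⊗ₜ[ℂ] xm g q δ Γ i z + xm g q δ Γ i (z * (b : ℂˣ) ^ 2) ⊗ₜ[ℂ] psi g q δ Γ i (z * b)
  on_phi : ∀ {a b c : Γ} (hc : c = a * b) (i : Fin (n - 1)) (z : ℂˣ),
    H.comul hc (phi g q δ Γ i z) =
      phi g q δ Γ i (z * (b : ℂˣ)⁻¹) ⊗ₜ[ℂ] phi g q δ Γ i (z * a)
  on_psi : ∀ {a b c : Γ} (hc : c = a * b) (i : Fin (n - 1)) (z : ℂˣ),
    H.comul hc (psi g q δ Γ i z) =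
      psi g q δ Γ i (z * b) ⊗ₜ[ℂ] psi g q δ Γ i (z * (a : ℂˣ)⁻¹)

/-- The formulas for the counit. -/
structure CounitFormulas (H : HopfGroupCoalgebra ℂ Γ (U g q δ Γ)) : Prop where
  on_qc : H.counit (qc g q δ Γ 1) = 1
  on_xp : ∀ (i : Fin (n - 1)) (z : ℂˣ), H.counit (xp g q δ Γ i z) = 0
  on_xm : ∀ (i : Fin (n - 1)) (z : ℂˣ), H.counit (xm g q δ Γ i z) = 0
  on_phi : ∀ (i : Fin (n - 1)) (z : ℂˣ), H.counit (phi g q δ Γ i z) = 1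
  on_psi : ∀ (i : Fin (n - 1)) (z : ℂˣ), H.counit (psi g q δ Γ i z) = 1

/-- The formulas for the antipode, from the specialisation at `a` to that at `b = a⁻¹`; on the
right-hand sides `q^{c/2}` has the value `b`. -/
structure AntipodeFormulas (H : HopfGroupCoalgebra ℂ Γ (U g q δ Γ)) : Prop where
  on_qc : ∀ {a b : Γ} (hab : a * b = 1), (H.antipode hab (qc g q δ Γ a)).unop =
    algebraMap ℂ (U g q δ Γ b) (((b : ℂˣ) : ℂ) ^ 2)⁻¹
  on_xp : ∀ {a b : Γ} (hab : a * b = 1) (i : Fin (n - 1)) (z : ℂˣ),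
    (H.antipode hab (xp g q δ Γ i z)).unop =
      -(phiInv g q δ Γ i (z * (b : ℂˣ)⁻¹) * xp g q δ Γ i (z * ((b : ℂˣ) ^ 2)⁻¹))
  on_xm : ∀ {a b : Γ} (hab : a * b = 1) (i : Fin (n - 1)) (z : ℂˣ),
    (H.antipode hab (xm g q δ Γ i z)).unop =
      -(xm g q δ Γ i (z * ((b : ℂˣ) ^ 2)⁻¹) * psiInv g q δ Γ i (z * (b : ℂˣ)⁻¹))
  on_phi : ∀ {a b : Γ} (hab : a * b = 1) (i : Fin (n - 1)) (z : ℂˣ),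
    (H.antipode hab (phi g q δ Γ i z)).unop = phiInv g q δ Γ i z
  on_psi : ∀ {a b : Γ} (hab : a * b = 1) (i : Fin (n - 1)) (z : ℂˣ),
    (H.antipode hab (psi g q δ Γ i z)).unop = psiInv g q δ Γ i z

end

end FunctionalAlgebra

/-! Each structure map is defined on generators and extended to the quotient, so existence amounts
to showing that the proposed images of the generators satisfy the defining relations. `IsRep`
records what has to be checked, with conjugations rewritten as commutation up to a scalar. The
commuting and cubic relations are left out because they follow from the quadratic ones: g_ij = 1
gives the first, and `h` is exactly the coefficient that makes the second hold once every monomial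
is reordered (`IsRep.rel`).

The coproduct is then a fusion rule. A family at `a` and a family at `b` give one at `a * b` in the
tensor product (`IsRep.comulGen`). The spectral shifts make the scalars telescope: a factor of g_ij
produced at an intermediate point in one tensor factor is cancelled by the other. Cancellation needs
the intermediate point to be neither a zero nor a pole, which is what regularity along a coset of
`Γ` guarantees. The antipode similarly turns a family at b = a⁻¹ into a family at `a` in the
opposite algebra (`IsRep.antipodeGen`).

Coassociativity and the counit laws are equalities of algebra homomorphisms, hence can be tested on
generators. The maps in the antipode laws are not multiplicative, but the elements on which such a
law holds form a subalgebra (`mulLeftAnti_mul`, `mulRightAnti_mul`), so generators suffice again.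
Uniqueness holds because the currents, together with the forced inverses of φ and ψ, generate. -/

namespace FunctionalAlgebra

/-! ### Regularity along cosets of `Γ` -/

section Reg

variable {n : ℕ} {g : Fin (n - 1) → Fin (n - 1) → ℂ → ℂ} {Γ : Subgroup ℂˣ}

/-- The condition depends only on the coset. The equation for `v` is a separate hypothesis so that
each application reduces to an identity of monomials in ℂˣ. -/
theorem RegularAlong.shift {i j : Fin (n - 1)} {u v : ℂˣ} (hr : RegularAlong g Γ i j u)
    (l : Γ) (hv : v = u * l) : RegularAlong g Γ i j v := by
  intro m hm
  rw [hv, mul_assoc]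
  exact hr _ (Γ.mul_mem l.2 hm)

theorem RegularAlong.ne_zero {i j : Fin (n - 1)} {u v : ℂˣ} (hr : RegularAlong g Γ i j u)
    (l : Γ) (hv : v = u * l) : g i j (v : ℂ) ≠ 0 := by
  rw [hv]
  exact hr _ l.2

theorem IsStructureFunctions.inversion_div (hg : IsStructureFunctions n g) (i j : Fin (n - 1))
    (z w : ℂˣ) : g i j ((z / w : ℂˣ) : ℂ) = (g j i ((w / z : ℂˣ) : ℂ))⁻¹ := by
  rw [hg.inversion i j _ (Units.ne_zero _), ← Units.val_inv_eq_inv_val, inv_div]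

end Reg

/-- A family of elements satisfying the defining relations of the specialisation at
`q^{c/2} = t`, except for those which follow from the quadratic relations. -/
structure IsRep {n : ℕ} (g : Fin (n - 1) → Fin (n - 1) → ℂ → ℂ) (q : ℂ) (δ : ℂˣ → ℂ)
    (Γ : Subgroup ℂˣ) (t : ℂˣ) {A : Type} [Ring A] [Algebra ℂ A] (f : Gen n → A) : Prop where
  phi_mul_inv : ∀ (i : Fin (n - 1)) (z : ℂˣ), f (.phi i z) * f (.phiInv i z) = 1
  phi_inv_mul : ∀ (i : Fin (n - 1)) (z : ℂˣ), f (.phiInv i z) * f (.phi i z) = 1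
  psi_mul_inv : ∀ (i : Fin (n - 1)) (z : ℂˣ), f (.psi i z) * f (.psiInv i z) = 1
  psi_inv_mul : ∀ (i : Fin (n - 1)) (z : ℂˣ), f (.psiInv i z) * f (.psi i z) = 1
  phi_phi : ∀ (i j : Fin (n - 1)) (z w : ℂˣ),
    f (.phi i z) * f (.phi j w) = f (.phi j w) * f (.phi i z)
  psi_psi : ∀ (i j : Fin (n - 1)) (z w : ℂˣ),
    f (.psi i z) * f (.psi j w) = f (.psi j w) * f (.psi i z)
  phi_psi : ∀ (i j : Fin (n - 1)) (z w u v : ℂˣ), RegularAlong g Γ i j (z / w) →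
    u = z / w * (t ^ 2)⁻¹ → v = z / w * t ^ 2 → f (.phi i z) * f (.psi j w) =
      (g i j (u : ℂ) / g i j (v : ℂ)) • (f (.psi j w) * f (.phi i z))
  phi_xp : ∀ (i j : Fin (n - 1)) (z w u : ℂˣ), g i j (u : ℂ) ≠ 0 → u = z / w * t⁻¹ →
    f (.phi i z) * f (.xp j w) = g i j (u : ℂ) • (f (.xp j w) * f (.phi i z))
  phi_xm : ∀ (i j : Fin (n - 1)) (z w u : ℂˣ), RegularAlong g Γ i j (z / w) → u = z / w * t →
    f (.phi i z) * f (.xm j w) = (g i j (u : ℂ))⁻¹ • (f (.xm j w) * f (.phi i z))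
  psi_xp : ∀ (i j : Fin (n - 1)) (z w u : ℂˣ), RegularAlong g Γ j i (w / z) → u = w / z * t⁻¹ →
    f (.psi i z) * f (.xp j w) = (g j i (u : ℂ))⁻¹ • (f (.xp j w) * f (.psi i z))
  psi_xm : ∀ (i j : Fin (n - 1)) (z w u : ℂˣ), g j i (u : ℂ) ≠ 0 → u = w / z * t →
    f (.psi i z) * f (.xm j w) = g j i (u : ℂ) • (f (.xm j w) * f (.psi i z))
  xp_xm_same : ∀ (i : Fin (n - 1)) (z w : ℂˣ), RegularAlong g Γ i i (z / w) →
    f (.xp i z) * f (.xm i w) - f (.xm i w) * f (.xp i z) =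
      (1 / (q - q⁻¹)) • (δ (z / w * (t ^ 2)⁻¹) • f (.psi i (w * t)) -
        δ (z / w * t ^ 2) • f (.phi i (z * t)))
  xp_xm_ne : ∀ (i j : Fin (n - 1)) (z w : ℂˣ), i ≠ j → RegularAlong g Γ i j (z / w) →
    f (.xp i z) * f (.xm j w) = f (.xm j w) * f (.xp i z)
  xp_xp : ∀ (i j : Fin (n - 1)) (z w : ℂˣ), g i j ((z / w : ℂˣ) : ℂ) ≠ 0 →
    f (.xp i z) * f (.xp j w) = g i j ((z / w : ℂˣ) : ℂ) • (f (.xp j w) * f (.xp i z))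
  xm_xm : ∀ (i j : Fin (n - 1)) (z w : ℂˣ), g i j ((z / w : ℂˣ) : ℂ) ≠ 0 →
    f (.xm i z) * f (.xm j w) = (g i j ((z / w : ℂˣ) : ℂ))⁻¹ • (f (.xm j w) * f (.xm i z))

/-! ### Commutation up to a scalar -/

section Algebra

variable {A : Type} [Ring A] [Algebra ℂ A]

/-- The cubic relation follows from the quadratic ones. -/
theorem cubic_of_quadratic {x₁ x₂ y : A} {p u v c d : ℂ} (h₁₂ : x₁ * x₂ = p • (x₂ * x₁))
    (h₁ : x₁ * y = u • (y * x₁)) (h₂ : x₂ * y = v • (y * x₂))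
    (hc : (u * v + 1) * (p + 1) = c * u * p + d * v) :
    (x₁ * x₂ * y - c • (x₁ * y * x₂) + y * x₁ * x₂)
      + (x₂ * x₁ * y - d • (x₂ * y * x₁) + y * x₂ * x₁) = 0 := by
  -- All six monomials are scalar multiples of y x₂ x₁; `hc` says that the total coefficient
  -- vanishes.
  have e₁ : x₂ * x₁ * y = (u * v) • (y * x₂ * x₁) := by
    rw [mul_assoc, h₁, mul_smul_comm, ← mul_assoc, h₂, smul_mul_assoc, smul_smul]
  have e₂ : x₁ * x₂ * y = (p * (u * v)) • (y * x₂ * x₁) := by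
    rw [h₁₂, smul_mul_assoc, e₁, smul_smul]
  have e₃ : x₁ * y * x₂ = (u * p) • (y * x₂ * x₁) := by
    rw [h₁, smul_mul_assoc, mul_assoc, h₁₂, mul_smul_comm, smul_smul, mul_assoc]
  have e₄ : y * x₁ * x₂ = p • (y * x₂ * x₁) := by
    rw [mul_assoc, h₁₂, mul_smul_comm, mul_assoc]
  have e₅ : x₂ * y * x₁ = v • (y * x₂ * x₁) := by
    rw [h₂, smul_mul_assoc]
  rw [e₁, e₂, e₃, e₄, e₅]
  have : (p * (u * v) - c * (u * p) + p) + (u * v - d * v + 1) = 0 := by linear_combination hc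
  rw [← zero_smul ℂ (y * x₂ * x₁), ← this]
  module

/-- Conjugation in terms of commutation. -/
theorem conj_eq_smul {p p' x : A} {r : ℂ} (h : p * p' = 1) (hx : p * x = r • (x * p)) :
    p * x * p' = r • x := by
  rw [hx, smul_mul_assoc, mul_assoc, h, mul_one]

theorem commute_of_conj {p p' x : A} {r : ℂ} (h : p' * p = 1) (hx : p * x * p' = r • x) :
    p * x = r • (x * p) := by
  rw [← smul_mul_assoc, ← hx, mul_assoc, h, mul_one]

theorem inv_commute {p p' x : A} {r : ℂ} (h : p' * p = 1) (h' : p * p' = 1)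
    (hx : p * x = r • (x * p)) : x * p' = r • (p' * x) := by
  calc x * p' = p' * (p * x) * p' := by rw [← mul_assoc p', h, one_mul]
    _ = r • (p' * x) := by
      rw [hx, mul_smul_comm, smul_mul_assoc, mul_assoc, mul_assoc x, h', mul_one]

theorem inv_commute' {p p' x : A} {r : ℂ} (hr : r ≠ 0) (h : p' * p = 1) (h' : p * p' = 1)
    (hx : p * x = r • (x * p)) : p' * x = r⁻¹ • (x * p') := by
  rw [inv_commute h h' hx, smul_smul, inv_mul_cancel₀ hr, one_smul]

end Algebra

/-! ### Families satisfying the relations, and maps out of a specialisation -/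

section Lift

variable {n : ℕ} {g : Fin (n - 1) → Fin (n - 1) → ℂ → ℂ} {q : ℂ} {δ : ℂˣ → ℂ}
  {Γ : Subgroup ℂˣ} {A : Type} [Ring A] [Algebra ℂ A]

/-- Exchanging z₁ and z₂ replaces p = g_ii(z₁/z₂) by p⁻¹, which multiplies numerator and denominator
of `h` by the same factor p⁻¹. Hence both cubic terms carry one coefficient, and a single
nonvanishing denominator suffices. -/
theorem h_swap_and_mul_den (hg : IsStructureFunctions n g) (i j : Fin (n - 1)) (z₁ z₂ w : ℂˣ)
    (hr : g i i ((z₁ / z₂ : ℂˣ) : ℂ) ≠ 0)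
    (hd : hDen g i j ((z₁ / w : ℂˣ) : ℂ) ((z₂ / w : ℂˣ) : ℂ) ≠ 0) :
    h g i j ((z₂ / w : ℂˣ) : ℂ) ((z₁ / w : ℂˣ) : ℂ) =
        h g i j ((z₁ / w : ℂˣ) : ℂ) ((z₂ / w : ℂˣ) : ℂ) ∧
      h g i j ((z₁ / w : ℂˣ) : ℂ) ((z₂ / w : ℂˣ) : ℂ) *
          (g i j ((z₂ / w : ℂˣ) : ℂ) + g i i ((z₁ / z₂ : ℂˣ) : ℂ) * g i j ((z₁ / w : ℂˣ) : ℂ)) =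
        (g i i ((z₁ / z₂ : ℂˣ) : ℂ) + 1) *
          (g i j ((z₁ / w : ℂˣ) : ℂ) * g i j ((z₂ / w : ℂˣ) : ℂ) + 1) := by
  have e₁ : ((z₁ / w : ℂˣ) : ℂ) / ((z₂ / w : ℂˣ) : ℂ) = ((z₁ / z₂ : ℂˣ) : ℂ) := by
    push_cast
    field_simp
  have e₂ : ((z₂ / w : ℂˣ) : ℂ) / ((z₁ / w : ℂˣ) : ℂ) = ((z₂ / z₁ : ℂˣ) : ℂ) := by
    push_cast
    field_simp
  rw [hDen, e₁] at hd
  simp only [h, hDen, e₁, e₂]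
  rw [hg.inversion_div i i z₂ z₁]
  generalize g i i ((z₁ / z₂ : ℂˣ) : ℂ) = p at *
  generalize g i j ((z₁ / w : ℂˣ) : ℂ) = u at *
  generalize g i j ((z₂ / w : ℂˣ) : ℂ) = v at *
  have hd' : u + p⁻¹ * v ≠ 0 := by
    intro h0
    apply hd
    have : p * (u + p⁻¹ * v) = 0 := by rw [h0, mul_zero]
    rw [mul_add, ← mul_assoc, mul_inv_cancel₀ hr, one_mul] at this
    rw [add_comm, this]
  refine ⟨?_, div_mul_cancel₀ _ hd⟩
  rw [div_eq_div_iff hd' hd]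
  field_simp
  ring

theorem IsRep.rel (hg : IsStructureFunctions n g) {t : ℂˣ} {f : Gen n → A}
    (hf : IsRep g q δ Γ t f) ⦃x y : Free n⦄ (hxy : Rel g q δ Γ t x y) :
    FreeAlgebra.lift ℂ f x = FreeAlgebra.lift ℂ f y := by
  induction hxy with
  | phi_mul_inv i z => simpa [Free.phi, Free.phiInv] using hf.phi_mul_inv i z
  | phi_inv_mul i z => simpa [Free.phi, Free.phiInv] using hf.phi_inv_mul i z
  | psi_mul_inv i z => simpa [Free.psi, Free.psiInv] using hf.psi_mul_inv i z
  | psi_inv_mul i z => simpa [Free.psi, Free.psiInv] using hf.psi_inv_mul i z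
  | phi_phi i j z w => simpa [Free.phi] using hf.phi_phi i j z w
  | psi_psi i j z w => simpa [Free.psi] using hf.psi_psi i j z w
  | phi_psi i j z w hr =>
    simp only [Free.phi, Free.psi, Free.phiInv, Free.psiInv, map_mul, FreeAlgebra.lift_ι_apply,
      AlgHom.commutes]
    rw [conj_eq_smul (hf.phi_mul_inv i z) (hf.phi_psi i j z w _ _ hr rfl rfl), smul_mul_assoc,
      hf.psi_mul_inv, Algebra.algebraMap_eq_smul_one]
  | phi_xp i j z w hr =>
    simp only [Free.phi, Free.xp, Free.phiInv, map_mul, map_smul, FreeAlgebra.lift_ι_apply]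
    exact conj_eq_smul (hf.phi_mul_inv i z) (hf.phi_xp i j z w _ hr rfl)
  | phi_xm i j z w hr =>
    simp only [Free.phi, Free.xm, Free.phiInv, map_mul, map_smul, FreeAlgebra.lift_ι_apply]
    exact conj_eq_smul (hf.phi_mul_inv i z) (hf.phi_xm i j z w _ hr rfl)
  | psi_xp i j z w hr =>
    simp only [Free.psi, Free.xp, Free.psiInv, map_mul, map_smul, FreeAlgebra.lift_ι_apply]
    exact conj_eq_smul (hf.psi_mul_inv i z) (hf.psi_xp i j z w _ hr rfl)
  | psi_xm i j z w hr =>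
    simp only [Free.psi, Free.xm, Free.psiInv, map_mul, map_smul, FreeAlgebra.lift_ι_apply]
    exact conj_eq_smul (hf.psi_mul_inv i z) (hf.psi_xm i j z w _ hr rfl)
  | xp_xm_same i z w hr =>
    simp only [Free.psi, Free.phi, Free.xp, Free.xm, map_mul, map_smul, map_sub,
      FreeAlgebra.lift_ι_apply]
    exact hf.xp_xm_same i z w hr
  | xp_xm_ne i j hij z w hr =>
    simp only [Free.xp, Free.xm, map_mul, map_sub, map_zero, FreeAlgebra.lift_ι_apply]
    exact sub_eq_zero.2 (hf.xp_xm_ne i j z w hij hr)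
  | xp_xp i j z w hr =>
    simp only [Free.xp, map_mul, map_smul, FreeAlgebra.lift_ι_apply]
    exact hf.xp_xp i j z w hr
  | xm_xm i j z w hr =>
    simp only [Free.xm, map_mul, map_smul, FreeAlgebra.lift_ι_apply]
    exact hf.xm_xm i j z w hr
  | xp_comm i j ha z w =>
    have h1 := hg.commuting i j ha _ (z / w).ne_zero
    simp only [Free.xp, map_mul, map_sub, map_zero, FreeAlgebra.lift_ι_apply]
    have := hf.xp_xp i j z w (by rw [h1]; exact one_ne_zero)
    rw [h1, one_smul] at this
    exact sub_eq_zero.2 this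
  | xm_comm i j ha z w =>
    have h1 := hg.commuting i j ha _ (z / w).ne_zero
    simp only [Free.xm, map_mul, map_sub, map_zero, FreeAlgebra.lift_ι_apply]
    have := hf.xm_xm i j z w (by rw [h1]; exact one_ne_zero)
    rw [h1, inv_one, one_smul] at this
    exact sub_eq_zero.2 this
  | xp_serre i j ha z₁ z₂ w hr hr₁ hr₂ hd =>
    simp only [Free.xp, map_mul, map_sub, map_add, map_smul, map_zero, FreeAlgebra.lift_ι_apply]
    obtain ⟨e₁, e₂⟩ := h_swap_and_mul_den hg i j z₁ z₂ w hr hd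
    refine cubic_of_quadratic (hf.xp_xp i i z₁ z₂ hr) (hf.xp_xp i j z₁ w hr₁)
      (hf.xp_xp i j z₂ w hr₂) ?_
    rw [e₁]
    linear_combination -e₂
  | xm_serre i j ha z₁ z₂ w hr hr₁ hr₂ hd =>
    simp only [Free.xm, map_mul, map_sub, map_add, map_smul, map_zero, FreeAlgebra.lift_ι_apply]
    obtain ⟨e₁, e₂⟩ := h_swap_and_mul_den hg i j z₁ z₂ w hr hd
    refine cubic_of_quadratic (hf.xm_xm i i z₁ z₂ hr) (hf.xm_xm i j z₁ w hr₁)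
      (hf.xm_xm i j z₂ w hr₂) ?_
    rw [e₁]
    -- For x⁻ the scalars are the inverses of those for x⁺. Multiplying the coefficient identity by
    -- p u v gives back the one for x⁺, so the same `h` serves both signs.
    field_simp
    linear_combination -e₂

/-- The homomorphism from a specialisation given by a family satisfying its relations. -/
noncomputable def IsRep.lift (hg : IsStructureFunctions n g) {t : Γ} {f : Gen n → A}
    (hf : IsRep g q δ Γ (t : ℂˣ) f) : U g q δ Γ t →ₐ[ℂ] A :=
  RingQuot.liftAlgHom ℂ ⟨FreeAlgebra.lift ℂ f, hf.rel hg⟩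

variable (g q δ Γ) in
/-- The generators of a specialisation. -/
noncomputable def gen (t : Γ) (x : Gen n) : U g q δ Γ t := mk g q δ Γ t (FreeAlgebra.ι ℂ x)

theorem IsRep.lift_gen (hg : IsStructureFunctions n g) {t : Γ} {f : Gen n → A}
    (hf : IsRep g q δ Γ (t : ℂˣ) f) (x : Gen n) : hf.lift hg (gen g q δ Γ t x) = f x :=
  (RingQuot.liftAlgHom_mkAlgHom_apply (S := ℂ) _ (hf.rel hg) _).trans
    (FreeAlgebra.lift_ι_apply _ _)

theorem U.algHom_ext {t : Γ} {F G : U g q δ Γ t →ₐ[ℂ] A}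
    (hFG : ∀ x, F (gen g q δ Γ t x) = G (gen g q δ Γ t x)) : F = G :=
  RingQuot.ringQuot_ext' ℂ F G (FreeAlgebra.hom_ext (funext hFG))

theorem mk_surjective (t : Γ) : Function.Surjective (mk g q δ Γ t) :=
  RingQuot.mkAlgHom_surjective ℂ _

theorem mk_rel {t : Γ} {x y : Free n} (hxy : Rel g q δ Γ (t : ℂˣ) x y) :
    mk g q δ Γ t x = mk g q δ Γ t y :=
  RingQuot.mkAlgHom_rel ℂ hxy

@[simp]
theorem mk_xp (t : Γ) (i : Fin (n - 1)) (z : ℂˣ) :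
    mk g q δ Γ t (Free.xp i z) = gen g q δ Γ t (.xp i z) := rfl

@[simp]
theorem mk_xm (t : Γ) (i : Fin (n - 1)) (z : ℂˣ) :
    mk g q δ Γ t (Free.xm i z) = gen g q δ Γ t (.xm i z) := rfl

@[simp]
theorem mk_phi (t : Γ) (i : Fin (n - 1)) (z : ℂˣ) :
    mk g q δ Γ t (Free.phi i z) = gen g q δ Γ t (.phi i z) := rfl

@[simp]
theorem mk_phiInv (t : Γ) (i : Fin (n - 1)) (z : ℂˣ) :
    mk g q δ Γ t (Free.phiInv i z) = gen g q δ Γ t (.phiInv i z) := rfl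

@[simp]
theorem mk_psi (t : Γ) (i : Fin (n - 1)) (z : ℂˣ) :
    mk g q δ Γ t (Free.psi i z) = gen g q δ Γ t (.psi i z) := rfl

@[simp]
theorem mk_psiInv (t : Γ) (i : Fin (n - 1)) (z : ℂˣ) :
    mk g q δ Γ t (Free.psiInv i z) = gen g q δ Γ t (.psiInv i z) := rfl

/-- The universal family: the presentation read in commutation form. Feeding it to `IsRep.comulGen`
and `IsRep.antipodeGen` yields the structure maps. -/
theorem isRep_gen (t : Γ) : IsRep g q δ Γ (t : ℂˣ) (gen g q δ Γ t) where
  phi_mul_inv i z := by simpa using mk_rel (.phi_mul_inv i z)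
  phi_inv_mul i z := by simpa using mk_rel (.phi_inv_mul i z)
  psi_mul_inv i z := by simpa using mk_rel (.psi_mul_inv i z)
  psi_inv_mul i z := by simpa using mk_rel (.psi_inv_mul i z)
  phi_phi i j z w := by simpa using mk_rel (.phi_phi i j z w)
  psi_psi i j z w := by simpa using mk_rel (.psi_psi i j z w)
  phi_psi i j z w u v hr hu hv := by
    subst hu hv
    have := mk_rel (q := q) (δ := δ) (t := t) (.phi_psi i j z w hr)
    have e₁ := mk_rel (g := g) (q := q) (δ := δ) (t := t) (.phi_inv_mul i z)
    have e₂ := mk_rel (g := g) (q := q) (δ := δ) (t := t) (.psi_inv_mul j w)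
    simp only [map_mul, map_one, AlgHom.commutes] at this e₁ e₂
    refine commute_of_conj e₁ ?_
    simp only [mk_phi, mk_phiInv, mk_psi, mk_psiInv] at this e₂
    rw [Algebra.smul_def, ← this, mul_assoc _ _ (gen g q δ Γ t (.psi j w)), e₂, mul_one, mk_phiInv]
  phi_xp i j z w u hr hu := by
    subst hu
    exact commute_of_conj (by simpa using mk_rel (.phi_inv_mul i z))
      (by simpa using mk_rel (.phi_xp i j z w hr))
  phi_xm i j z w u hr hu := by
    subst hu
    exact commute_of_conj (by simpa using mk_rel (.phi_inv_mul i z))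
      (by simpa using mk_rel (.phi_xm i j z w hr))
  psi_xp i j z w u hr hu := by
    subst hu
    exact commute_of_conj (by simpa using mk_rel (.psi_inv_mul i z))
      (by simpa using mk_rel (.psi_xp i j z w hr))
  psi_xm i j z w u hr hu := by
    subst hu
    exact commute_of_conj (by simpa using mk_rel (.psi_inv_mul i z))
      (by simpa using mk_rel (.psi_xm i j z w hr))
  xp_xm_same i z w hr := by simpa using mk_rel (.xp_xm_same i z w hr)
  xp_xm_ne i j z w hij hr := by
    simpa [sub_eq_zero] using mk_rel (.xp_xm_ne i j hij z w hr)
  xp_xp i j z w hr := by simpa using mk_rel (.xp_xp i j z w hr)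
  xm_xm i j z w hr := by simpa using mk_rel (.xm_xm i j z w hr)

end Lift

/-! ### Counit and coproduct on generators -/

section Fusion

variable {n : ℕ} {g : Fin (n - 1) → Fin (n - 1) → ℂ → ℂ} {q : ℂ} {δ : ℂˣ → ℂ}
  {Γ : Subgroup ℂˣ} {A B : Type} [Ring A] [Algebra ℂ A] [Ring B] [Algebra ℂ B]

/-- The values of the counit on the generators. -/
def counitGen {n : ℕ} : Gen n → ℂ
  | .xp _ _ => 0
  | .xm _ _ => 0
  | .phi _ _ => 1
  | .phiInv _ _ => 1
  | .psi _ _ => 1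
  | .psiInv _ _ => 1

theorem isRep_counitGen : IsRep g q δ Γ 1 (counitGen (n := n)) where
  phi_mul_inv i z := by simp [counitGen]
  phi_inv_mul i z := by simp [counitGen]
  psi_mul_inv i z := by simp [counitGen]
  psi_inv_mul i z := by simp [counitGen]
  phi_phi i j z w := by simp [counitGen]
  psi_psi i j z w := by simp [counitGen]
  phi_psi i j z w u v hr hu hv := by
    -- At parameter 1 the two arguments coincide, but the ratio is 1 only at a regular point, since
    -- 0 / 0 = 0.
    have h0 : g i j (v : ℂ) ≠ 0 := hr.ne_zero 1 (by simp [hv])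
    have huv : u = v := by simp [hu, hv]
    simp [counitGen, huv, h0]
  phi_xp i j z w u hr hu := by simp [counitGen]
  phi_xm i j z w u hr hu := by simp [counitGen]
  psi_xp i j z w u hr hu := by simp [counitGen]
  psi_xm i j z w u hr hu := by simp [counitGen]
  xp_xm_same i z w hr := by simp [counitGen]
  xp_xm_ne i j z w hij hr := by simp [counitGen]
  xp_xp i j z w hr := by simp [counitGen]
  xm_xm i j z w hr := by simp [counitGen]

/-- The values of the coproduct on the generators, in a tensor product of two families. -/
def comulGen (a b : ℂˣ) (e : Gen n → A) (f : Gen n → B) : Gen n → A ⊗[ℂ] B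
  | .xp i z => e (.xp i z) ⊗ₜ 1 + e (.phi i (z * a)) ⊗ₜ f (.xp i (z * a ^ 2))
  | .xm i z => 1 ⊗ₜ f (.xm i z) + e (.xm i (z * b ^ 2)) ⊗ₜ f (.psi i (z * b))
  | .phi i z => e (.phi i (z * b⁻¹)) ⊗ₜ f (.phi i (z * a))
  | .phiInv i z => e (.phiInv i (z * b⁻¹)) ⊗ₜ f (.phiInv i (z * a))
  | .psi i z => e (.psi i (z * b)) ⊗ₜ f (.psi i (z * a⁻¹))
  | .psiInv i z => e (.psiInv i (z * b)) ⊗ₜ f (.psiInv i (z * a⁻¹))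

-- The shifts in the coproduct are such that tensor factors either produce the same scalar or share
-- an intermediate argument of g_ij that cancels.
open Algebra.TensorProduct TensorProduct in
theorem IsRep.comulGen (hg : IsStructureFunctions n g) {a b c : Γ} (hc : c = a * b)
    {e : Gen n → A} {f : Gen n → B} (he : IsRep g q δ Γ (a : ℂˣ) e)
    (hf : IsRep g q δ Γ (b : ℂˣ) f) :
    IsRep g q δ Γ (c : ℂˣ) (comulGen (a : ℂˣ) (b : ℂˣ) e f) where
  phi_mul_inv i z := by
    simp only [FunctionalAlgebra.comulGen, tmul_mul_tmul, he.phi_mul_inv, hf.phi_mul_inv]; rfl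
  phi_inv_mul i z := by
    simp only [FunctionalAlgebra.comulGen, tmul_mul_tmul, he.phi_inv_mul, hf.phi_inv_mul]; rfl
  psi_mul_inv i z := by
    simp only [FunctionalAlgebra.comulGen, tmul_mul_tmul, he.psi_mul_inv, hf.psi_mul_inv]; rfl
  psi_inv_mul i z := by
    simp only [FunctionalAlgebra.comulGen, tmul_mul_tmul, he.psi_inv_mul, hf.psi_inv_mul]; rfl
  phi_phi i j z w := by
    simp only [FunctionalAlgebra.comulGen, tmul_mul_tmul]
    rw [he.phi_phi, hf.phi_phi]
  psi_psi i j z w := by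
    simp only [FunctionalAlgebra.comulGen, tmul_mul_tmul]
    rw [he.psi_psi, hf.psi_psi]
  phi_psi i j z w u v hr hu hv := by
    -- With m this intermediate point, the left tensor factor contributes g(u)/g(m) and the right
    -- one g(m)/g(v).
    have h0 : g i j ((z / w * (a ^ 2 / b ^ 2) : ℂˣ) : ℂ) ≠ 0 :=
      hr.ne_zero (a ^ 2 / b ^ 2) (by simp)
    simp only [FunctionalAlgebra.comulGen, tmul_mul_tmul]
    rw [he.phi_psi i j _ _ u (z / w * (a ^ 2 / b ^ 2))
        (hr.shift (b ^ 2)⁻¹ (by ext; push_cast; field_simp))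
        (by rw [hu, hc]; ext; push_cast; field_simp) (by ext; push_cast; field_simp),
      hf.phi_psi i j _ _ (z / w * (a ^ 2 / b ^ 2)) v
        (hr.shift (a ^ 2) (by ext; push_cast; field_simp))
        (by ext; push_cast; field_simp) (by rw [hv, hc]; ext; push_cast; field_simp),
      tmul_smul, ← smul_tmul', smul_smul]
    congr 1
    field_simp
  phi_xp i j z w u hr hu := by
    simp only [FunctionalAlgebra.comulGen, tmul_mul_tmul, mul_add, add_mul, mul_one, one_mul]
    -- Both summands of Δ(x⁺) meet g_ij at the original argument `u`, so regularity at this one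
    -- point is enough.
    rw [he.phi_xp i j _ _ u hr (by rw [hu, hc]; ext; push_cast; field_simp),
      hf.phi_xp i j _ _ u hr (by rw [hu, hc]; ext; push_cast; field_simp), he.phi_phi,
      tmul_smul, ← smul_tmul', smul_add]
  phi_xm i j z w u hr hu := by
    -- In the summand x⁻ ⊗ ψ, moving φ past x⁻ gives 1/g(m) and moving φ past ψ gives g(m)/g(u),
    -- with m this point.
    have h0 : g i j ((z / w * (a / b ^ 3) : ℂˣ) : ℂ) ≠ 0 := hr.ne_zero (a / b ^ 3) (by simp)
    simp only [FunctionalAlgebra.comulGen, tmul_mul_tmul, mul_add, add_mul, mul_one, one_mul]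
    rw [hf.phi_xm i j _ _ u (hr.shift a (by ext; push_cast; field_simp))
        (by rw [hu, hc]; ext; push_cast; field_simp),
      he.phi_xm i j _ _ (z / w * (a / b ^ 3))
        (hr.shift (b ^ 3)⁻¹ (by ext; push_cast; field_simp)) (by ext; push_cast; field_simp),
      hf.phi_psi i j _ _ (z / w * (a / b ^ 3)) u
        (hr.shift (a / b) (by ext; push_cast; field_simp))
        (by ext; push_cast; field_simp) (by rw [hu, hc]; ext; push_cast; field_simp),
      tmul_smul, tmul_smul, ← smul_tmul', smul_smul, smul_add]
    congr 2
    field_simp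
  psi_xp i j z w u hr hu := by
    have h0 : g j i ((w / z * (a ^ 3 / b) : ℂˣ) : ℂ) ≠ 0 := hr.ne_zero (a ^ 3 / b) (by simp)
    have h1 : g j i (u : ℂ) ≠ 0 := hr.ne_zero c⁻¹ (by simp [hu])
    simp only [FunctionalAlgebra.comulGen, tmul_mul_tmul, mul_add, add_mul, mul_one, one_mul]
    rw [he.psi_xp i j _ _ u (hr.shift b⁻¹ (by ext; push_cast; field_simp))
        (by rw [hu, hc]; ext; push_cast; field_simp),
      hf.psi_xp i j _ _ (w / z * (a ^ 3 / b))
        (hr.shift (a ^ 3) (by ext; push_cast; field_simp)) (by ext; push_cast; field_simp),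
      he.phi_psi j i _ _ u (w / z * (a ^ 3 / b))
        (hr.shift (a / b) (by ext; push_cast; field_simp))
        (by rw [hu, hc]; ext; push_cast; field_simp) (by ext; push_cast; field_simp),
      tmul_smul, ← smul_tmul', ← smul_tmul', smul_add, smul_smul]
    congr 2
    field_simp
  psi_xm i j z w u hr hu := by
    simp only [FunctionalAlgebra.comulGen, tmul_mul_tmul, mul_add, add_mul, mul_one, one_mul]
    rw [hf.psi_xm i j _ _ u hr (by rw [hu, hc]; ext; push_cast; field_simp),
      he.psi_xm i j _ _ u hr (by rw [hu, hc]; ext; push_cast; field_simp), hf.psi_psi,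
      tmul_smul, ← smul_tmul', smul_add]
  xp_xm_same i z w hr := by
    have h0 : g i i ((z / w * (a ^ 2 / b ^ 2) : ℂˣ) : ℂ) ≠ 0 :=
      hr.ne_zero (a ^ 2 / b ^ 2) (by simp)
    have ha := he.xp_xm_same i z (w * b ^ 2) (hr.shift (b ^ 2)⁻¹ (by ext; push_cast; field_simp))
    have hb := hf.xp_xm_same i (z * a ^ 2) w (hr.shift (a ^ 2) (by ext; push_cast; field_simp))
    -- The mixed term drops out of the commutator: φ past x⁻ on the left and ψ past x⁺ on the right
    -- give the same scalar.
    have hx : (e (.phi i (z * a)) * e (.xm i (w * b ^ 2))) ⊗ₜ[ℂ]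
          (f (.xp i (z * a ^ 2)) * f (.psi i (w * b))) =
        (e (.xm i (w * b ^ 2)) * e (.phi i (z * a))) ⊗ₜ[ℂ]
          (f (.psi i (w * b)) * f (.xp i (z * a ^ 2))) := by
      rw [he.phi_xm i i _ _ (z / w * (a ^ 2 / b ^ 2))
          (hr.shift (a / b ^ 2) (by ext; push_cast; field_simp)) (by ext; push_cast; field_simp),
        hf.psi_xp i i _ _ (z / w * (a ^ 2 / b ^ 2))
          (hr.shift (a ^ 2 / b) (by ext; push_cast; field_simp)) (by ext; push_cast; field_simp),
        tmul_smul, smul_tmul']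
    have e₁ : z / (w * (b : ℂˣ) ^ 2) * ((a : ℂˣ) ^ 2)⁻¹ = z / w * ((c : ℂˣ) ^ 2)⁻¹ := by
      rw [hc]; ext; push_cast; field_simp
    -- The φ-term of the left commutator and the ψ-term of the right one have equal δ-arguments;
    -- both are multiples of φ(za) ⊗ ψ(wb), with opposite signs. The remaining two terms are Δ(ψ)
    -- and Δ(φ).
    have e₂ : z / (w * (b : ℂˣ) ^ 2) * (a : ℂˣ) ^ 2 = z * (a : ℂˣ) ^ 2 / w * ((b : ℂˣ) ^ 2)⁻¹ := by
      ext; push_cast; field_simp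
    have e₃ : z * (a : ℂˣ) ^ 2 / w * (b : ℂˣ) ^ 2 = z / w * (c : ℂˣ) ^ 2 := by
      rw [hc]; ext; push_cast; field_simp
    have e₄ : w * (b : ℂˣ) ^ 2 * a = w * c * b := by
      rw [hc]; ext; push_cast; ring
    have e₅ : w * (b : ℂˣ) = w * c * (a : ℂˣ)⁻¹ := by
      rw [hc]; ext; push_cast; field_simp
    have e₆ : z * (a : ℂˣ) = z * c * (b : ℂˣ)⁻¹ := by
      rw [hc]; ext; push_cast; field_simp
    have e₇ : z * (a : ℂˣ) ^ 2 * b = z * c * a := by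
      rw [hc]; ext; push_cast; ring
    rw [e₁, e₂, e₄] at ha
    rw [e₃, e₇] at hb
    simp only [FunctionalAlgebra.comulGen, tmul_mul_tmul, mul_add, add_mul, mul_one, one_mul]
    rw [hx]
    have hA := congrArg (· ⊗ₜ[ℂ] f (.psi i (w * b))) ha
    have hB := congrArg (e (.phi i (z * a)) ⊗ₜ[ℂ] ·) hb
    simp only [sub_tmul, tmul_sub, ← smul_tmul', tmul_smul] at hA hB
    rw [← e₅, ← e₆]
    linear_combination (norm := module) hA + hB
  xp_xm_ne i j z w hij hr := by
    have h0 : g i j ((z / w * (a ^ 2 / b ^ 2) : ℂˣ) : ℂ) ≠ 0 :=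
      hr.ne_zero (a ^ 2 / b ^ 2) (by simp)
    simp only [FunctionalAlgebra.comulGen, tmul_mul_tmul, mul_add, add_mul, mul_one, one_mul]
    rw [he.xp_xm_ne i j _ _ hij (hr.shift (b ^ 2)⁻¹ (by ext; push_cast; field_simp)),
      hf.xp_xm_ne i j _ _ hij (hr.shift (a ^ 2) (by ext; push_cast; field_simp)),
      he.phi_xm i j _ _ (z / w * (a ^ 2 / b ^ 2))
        (hr.shift (a / b ^ 2) (by ext; push_cast; field_simp)) (by ext; push_cast; field_simp),
      hf.psi_xp j i _ _ (z / w * (a ^ 2 / b ^ 2))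
        (hr.shift (a ^ 2 / b) (by ext; push_cast; field_simp)) (by ext; push_cast; field_simp),
      tmul_smul, smul_tmul']
    abel
  xp_xp i j z w hr := by
    -- Inversion matches the mixed terms: φ_j past x_i gives g_ji(w/z), which cancels the overall
    -- factor g_ij(z/w).
    have hr' := hg.inversion_div i j z w
    have hr'' : g j i ((w / z : ℂˣ) : ℂ) ≠ 0 := by
      rw [hg.inversion_div]; exact inv_ne_zero hr
    simp only [FunctionalAlgebra.comulGen, tmul_mul_tmul, mul_add, add_mul, mul_one, one_mul]
    rw [he.xp_xp i j _ _ hr, he.phi_xp i j _ _ (z / w) hr (by ext; push_cast; field_simp),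
      he.phi_xp j i _ _ (w / z) hr'' (by ext; push_cast; field_simp), he.phi_phi i j,
      hf.xp_xp i j _ _ (by rw [mul_div_mul_right_eq_div]; exact hr), mul_div_mul_right_eq_div,
      hr']
    simp only [← smul_tmul', tmul_smul, smul_add, smul_smul, inv_mul_cancel₀ hr'', one_smul]
    abel
  xm_xm i j z w hr := by
    have hr' := hg.inversion_div i j z w
    have hr'' : g j i ((w / z : ℂˣ) : ℂ) ≠ 0 := by
      rw [hg.inversion_div]; exact inv_ne_zero hr
    simp only [FunctionalAlgebra.comulGen, tmul_mul_tmul, mul_add, add_mul, mul_one, one_mul]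
    rw [hf.xm_xm i j _ _ hr, hf.psi_xm i j _ _ (w / z) hr'' (by ext; push_cast; field_simp),
      hf.psi_xm j i _ _ (z / w) hr (by ext; push_cast; field_simp), hf.psi_psi i j,
      he.xm_xm i j _ _ (by rw [mul_div_mul_right_eq_div]; exact hr), mul_div_mul_right_eq_div,
      hr']
    simp only [← smul_tmul', tmul_smul, smul_add, smul_smul, inv_inv, mul_inv_cancel₀ hr'',
      one_smul]
    abel

end Fusion

/-! ### Antipode on generators -/

section Antipode

variable {n : ℕ} {g : Fin (n - 1) → Fin (n - 1) → ℂ → ℂ} {q : ℂ} {δ : ℂˣ → ℂ}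
  {Γ : Subgroup ℂˣ} {A : Type} [Ring A] [Algebra ℂ A]

/-- The values of the antipode on the generators; `b` is the value of `q^{c/2}` in the target. -/
def antipodeGen (b : ℂˣ) (f : Gen n → A) : Gen n → A
  | .xp i z => -(f (.phiInv i (z * b⁻¹)) * f (.xp i (z * (b ^ 2)⁻¹)))
  | .xm i z => -(f (.xm i (z * (b ^ 2)⁻¹)) * f (.psiInv i (z * b⁻¹)))
  | .phi i z => f (.phiInv i z)
  | .phiInv i z => f (.phi i z)
  | .psi i z => f (.psiInv i z)
  | .psiInv i z => f (.psi i z)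

theorem smul_commute_mul {x y z : A} {r s : ℂ} (hy : x * y = r • (y * x))
    (hz : x * z = s • (z * x)) : x * (y * z) = (r * s) • (y * z * x) := by
  rw [← mul_assoc, hy, smul_mul_assoc, mul_assoc, hz, mul_smul_comm, smul_smul, mul_assoc]

theorem smul_commute_symm {x y : A} {r : ℂ} (hr : r ≠ 0) (h : x * y = r • (y * x)) :
    y * x = r⁻¹ • (x * y) := by
  rw [h, smul_smul, inv_mul_cancel₀ hr, one_smul]

/-- Used with p = φ⁻¹ and s = ψ⁻¹, to bring the images of x⁺ and x⁻ to a form in which φ⁻¹ and ψ⁻¹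
enclose a product of the x's. -/
theorem cross_commute {p s x y : A} {k l m : ℂ} (h₁ : s * p = k • (p * s))
    (h₂ : y * p = l • (p * y)) (h₃ : s * x = m • (x * s)) (h : k * l * m = 1) :
    y * s * (p * x) = p * (y * x) * s := by
  calc y * s * (p * x) = y * (s * p) * x := by simp only [mul_assoc]
    _ = k • ((y * p) * (s * x)) := by rw [h₁]; simp only [mul_assoc, mul_smul_comm, smul_mul_assoc]
    _ = (k * l * m) • (p * (y * x) * s) := by
      rw [h₂, h₃]; simp only [mul_assoc, mul_smul_comm, smul_mul_assoc, smul_smul]; congr 1; ring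
    _ = _ := by rw [h, one_smul]

/-- The exchanges of x' with p, x' with x, and p' with x contribute r, r⁻¹ and r. So the products p
x, with p = φ⁻¹ and x = x⁺, obey the quadratic relation in the reversed order required by an
anti-homomorphism. -/
theorem quadratic_mul_left {p p' x x' : A} {r : ℂ} (hr : r ≠ 0) (h : p * p' = p' * p)
    (h₁ : x' * p = r • (p * x')) (h₂ : x * p' = r⁻¹ • (p' * x)) (hx : x * x' = r • (x' * x)) :
    p' * x' * (p * x) = r • (p * x * (p' * x')) := by
  calc p' * x' * (p * x) = p' * (x' * p) * x := by simp only [mul_assoc]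
    _ = r • (p * p' * (x' * x)) := by
      rw [h₁, h]; simp only [mul_assoc, mul_smul_comm, smul_mul_assoc]
    _ = p * p' * (x * x') := by rw [hx, mul_smul_comm]
    _ = r • (p * (x * p') * x') := by
      rw [h₂]
      simp only [mul_assoc, mul_smul_comm, smul_mul_assoc, smul_smul, mul_inv_cancel₀ hr, one_smul]
    _ = _ := by simp only [mul_assoc]

theorem quadratic_mul_right {p p' y y' : A} {r : ℂ} (hr : r ≠ 0) (h : p * p' = p' * p)
    (h₁ : p' * y = r⁻¹ • (y * p')) (h₂ : p * y' = r • (y' * p))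
    (hy : y * y' = r⁻¹ • (y' * y)) :
    y' * p' * (y * p) = r⁻¹ • (y * p * (y' * p')) := by
  calc y' * p' * (y * p) = y' * (p' * y) * p := by simp only [mul_assoc]
    _ = r⁻¹ • (y' * y * (p * p')) := by
      rw [h₁, h]; simp only [mul_assoc, mul_smul_comm, smul_mul_assoc]
    _ = y * y' * (p * p') := by rw [hy, smul_mul_assoc]
    _ = r⁻¹ • (y * (p * y') * p') := by
      rw [h₂]
      simp only [mul_assoc, mul_smul_comm, smul_mul_assoc, smul_smul, inv_mul_cancel₀ hr, one_smul]
    _ = _ := by simp only [mul_assoc]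

theorem inv_commute_inv {p p' s s' : A} (hp : p' * p = 1) (hp' : p * p' = 1) (hs : s' * s = 1)
    (hs' : s * s' = 1) {r : ℂ} (hr : r ≠ 0) (h : p * s = r • (s * p)) :
    s' * p' = r⁻¹ • (p' * s') :=
  smul_commute_symm hr (inv_commute hs hs' (inv_commute hp hp' h))

namespace IsRep

variable {t : ℂˣ} {f : Gen n → A}

theorem phi_commute_phiInv (hf : IsRep g q δ Γ t f) (i j : Fin (n - 1)) (z w : ℂˣ) :
    f (.phi i z) * f (.phiInv j w) = (1 : ℂ) • (f (.phiInv j w) * f (.phi i z)) :=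
  inv_commute (hf.phi_inv_mul j w) (hf.phi_mul_inv j w) (by rw [one_smul, hf.phi_phi])

theorem psi_commute_psiInv (hf : IsRep g q δ Γ t f) (i j : Fin (n - 1)) (z w : ℂˣ) :
    f (.psi i z) * f (.psiInv j w) = (1 : ℂ) • (f (.psiInv j w) * f (.psi i z)) :=
  inv_commute (hf.psi_inv_mul j w) (hf.psi_mul_inv j w) (by rw [one_smul, hf.psi_psi])

theorem phiInv_phiInv (hf : IsRep g q δ Γ t f) (i j : Fin (n - 1)) (z w : ℂˣ) :
    f (.phiInv i z) * f (.phiInv j w) = f (.phiInv j w) * f (.phiInv i z) := by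
  have := inv_commute (hf.phi_inv_mul i z) (hf.phi_mul_inv i z) (hf.phi_commute_phiInv i j z w)
  rw [this, one_smul]

theorem psiInv_psiInv (hf : IsRep g q δ Γ t f) (i j : Fin (n - 1)) (z w : ℂˣ) :
    f (.psiInv i z) * f (.psiInv j w) = f (.psiInv j w) * f (.psiInv i z) := by
  have := inv_commute (hf.psi_inv_mul i z) (hf.psi_mul_inv i z) (hf.psi_commute_psiInv i j z w)
  rw [this, one_smul]

end IsRep

theorem IsRep.antipode_cross {b : Γ} {f : Gen n → A}
    (hf : IsRep g q δ Γ (b : ℂˣ) f) (i j : Fin (n - 1)) (z w : ℂˣ)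
    (hr : RegularAlong g Γ i j (z / w)) :
    f (.xm j (w * ((b : ℂˣ) ^ 2)⁻¹)) * f (.psiInv j (w * (b : ℂˣ)⁻¹)) *
        (f (.phiInv i (z * (b : ℂˣ)⁻¹)) * f (.xp i (z * ((b : ℂˣ) ^ 2)⁻¹))) =
      f (.phiInv i (z * (b : ℂˣ)⁻¹)) * (f (.xm j (w * ((b : ℂˣ) ^ 2)⁻¹)) *
        f (.xp i (z * ((b : ℂˣ) ^ 2)⁻¹))) * f (.psiInv j (w * (b : ℂˣ)⁻¹)) := by
  have h₁ : g i j ((z / w * (b ^ 2)⁻¹ : ℂˣ) : ℂ) ≠ 0 := hr.ne_zero (b ^ 2)⁻¹ (by simp)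
  have h₂ : g i j ((z / w * b ^ 2 : ℂˣ) : ℂ) ≠ 0 := hr.ne_zero (b ^ 2) (by simp)
  -- The three scalars are g₂/g₁, 1/g₂ and g₁, where g₁ and g₂ are the values of g_ij in `h₁` and
  -- `h₂`.
  refine cross_commute
    (inv_commute_inv (hf.phi_inv_mul _ _) (hf.phi_mul_inv _ _) (hf.psi_inv_mul _ _)
      (hf.psi_mul_inv _ _) (div_ne_zero h₁ h₂)
      (hf.phi_psi i j _ _ _ _ (hr.shift 1 (by ext; push_cast; field_simp))
        (by ext; push_cast; field_simp) (by ext; push_cast; field_simp)))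
    (inv_commute (hf.phi_inv_mul _ _) (hf.phi_mul_inv _ _)
      (hf.phi_xm i j _ _ (z / w * b ^ 2) (hr.shift b (by ext; push_cast; field_simp))
        (by ext; push_cast; field_simp)))
    (inv_commute' (inv_ne_zero h₁) (hf.psi_inv_mul _ _) (hf.psi_mul_inv _ _)
      (hf.psi_xp j i _ _ (z / w * (b ^ 2)⁻¹) (hr.shift b⁻¹ (by ext; push_cast; field_simp))
        (by ext; push_cast; field_simp))) ?_
  field_simp

-- Three inversions are balanced here: that of the parameter, that of φ and ψ, and the reversal of
-- products in the opposite algebra.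
open MulOpposite in
theorem IsRep.antipodeGen (hg : IsStructureFunctions n g) {a b : Γ} (hab : a * b = 1)
    {f : Gen n → A} (hf : IsRep g q δ Γ (b : ℂˣ) f) :
    IsRep g q δ Γ (a : ℂˣ) (fun x => op (antipodeGen (b : ℂˣ) f x)) where
  phi_mul_inv i z := congrArg op (hf.phi_mul_inv i z)
  phi_inv_mul i z := congrArg op (hf.phi_inv_mul i z)
  psi_mul_inv i z := congrArg op (hf.psi_mul_inv i z)
  psi_inv_mul i z := congrArg op (hf.psi_inv_mul i z)
  phi_phi i j z w := congrArg op (hf.phiInv_phiInv j i w z)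
  psi_psi i j z w := congrArg op (hf.psiInv_psiInv j i w z)
  phi_psi i j z w u v hr hu hv := by
    have ha : (a : ℂˣ) = (b : ℂˣ)⁻¹ := by rw [eq_inv_of_mul_eq_one_left hab]; rfl
    rw [ha] at hu hv
    have h₁ : g i j (u : ℂ) ≠ 0 := hr.ne_zero (b ^ 2) (by simp [hu])
    have h₂ : g i j (v : ℂ) ≠ 0 := hr.ne_zero (b ^ 2)⁻¹ (by simp [hv])
    -- Inverting the parameter exchanges the arguments `u` and `v`, hence they are passed in the
    -- opposite order.
    have := inv_commute_inv (hf.phi_inv_mul _ _) (hf.phi_mul_inv _ _) (hf.psi_inv_mul _ _)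
      (hf.psi_mul_inv _ _) (div_ne_zero h₂ h₁)
      (hf.phi_psi i j z w v u hr (by simp [hv]) (by simp [hu]))
    rw [inv_div] at this
    exact congrArg op this
  phi_xp i j z w u hr hu := by
    have ha : (a : ℂˣ) = (b : ℂˣ)⁻¹ := by rw [eq_inv_of_mul_eq_one_left hab]; rfl
    rw [ha] at hu
    have := inv_commute (hf.phi_inv_mul _ _) (hf.phi_mul_inv _ _)
      (smul_commute_mul (hf.phi_commute_phiInv i j z (w * (b : ℂˣ)⁻¹))
        (hf.phi_xp i j z (w * ((b : ℂˣ) ^ 2)⁻¹) u hr (by rw [hu]; ext; push_cast; field_simp)))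
    rw [one_mul] at this
    simp only [FunctionalAlgebra.antipodeGen, ← op_mul, ← op_smul, neg_mul, mul_neg, this, smul_neg]
  phi_xm i j z w u hr hu := by
    have ha : (a : ℂˣ) = (b : ℂˣ)⁻¹ := by rw [eq_inv_of_mul_eq_one_left hab]; rfl
    rw [ha] at hu
    have h₁ : g i j (u : ℂ) ≠ 0 := hr.ne_zero b⁻¹ (by simp [hu])
    have h₂ : g i j ((z / w * b ^ 3 : ℂˣ) : ℂ) ≠ 0 := hr.ne_zero (b ^ 3) (by simp)
    have := inv_commute (hf.phi_inv_mul _ _) (hf.phi_mul_inv _ _)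
      (smul_commute_mul
        (hf.phi_xm i j z (w * ((b : ℂˣ) ^ 2)⁻¹) (z / w * b ^ 3)
          (hr.shift (b ^ 2) (by ext; push_cast; field_simp)) (by ext; push_cast; field_simp))
        (inv_commute (hf.psi_inv_mul j (w * (b : ℂˣ)⁻¹)) (hf.psi_mul_inv _ _)
          (smul_commute_symm (div_ne_zero h₁ h₂)
            (hf.phi_psi i j z (w * (b : ℂˣ)⁻¹) u (z / w * b ^ 3)
              (hr.shift b (by ext; push_cast; field_simp))
              (by rw [hu]; ext; push_cast; field_simp) (by ext; push_cast; field_simp)))))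
    rw [show (g i j ((z / w * b ^ 3 : ℂˣ) : ℂ))⁻¹ *
      (g i j (u : ℂ) / g i j ((z / w * b ^ 3 : ℂˣ) : ℂ))⁻¹ = (g i j (u : ℂ))⁻¹ by field_simp] at this
    simp only [FunctionalAlgebra.antipodeGen, ← op_mul, ← op_smul, neg_mul, mul_neg, this, smul_neg]
  psi_xp i j z w u hr hu := by
    have ha : (a : ℂˣ) = (b : ℂˣ)⁻¹ := by rw [eq_inv_of_mul_eq_one_left hab]; rfl
    rw [ha] at hu
    have h₁ : g j i (u : ℂ) ≠ 0 := hr.ne_zero b (by simp [hu])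
    have h₂ : g j i ((w / z * (b ^ 3)⁻¹ : ℂˣ) : ℂ) ≠ 0 := hr.ne_zero (b ^ 3)⁻¹ (by simp)
    have := inv_commute (hf.psi_inv_mul _ _) (hf.psi_mul_inv _ _)
      (smul_commute_mul
        (inv_commute (hf.phi_inv_mul j (w * (b : ℂˣ)⁻¹)) (hf.phi_mul_inv _ _)
          (hf.phi_psi j i (w * (b : ℂˣ)⁻¹) z (w / z * (b ^ 3)⁻¹) u
              (hr.shift b⁻¹ (by ext; push_cast; field_simp))
              (by ext; push_cast; field_simp) (by rw [hu]; ext; push_cast; field_simp)))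
        (hf.psi_xp i j z (w * ((b : ℂˣ) ^ 2)⁻¹) (w / z * (b ^ 3)⁻¹)
          (hr.shift (b ^ 2)⁻¹ (by ext; push_cast; field_simp)) (by ext; push_cast; field_simp)))
    rw [show g j i ((w / z * (b ^ 3)⁻¹ : ℂˣ) : ℂ) / g j i (u : ℂ) *
      (g j i ((w / z * (b ^ 3)⁻¹ : ℂˣ) : ℂ))⁻¹ = (g j i (u : ℂ))⁻¹ by field_simp] at this
    simp only [FunctionalAlgebra.antipodeGen, ← op_mul, ← op_smul, neg_mul, mul_neg, this, smul_neg]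
  psi_xm i j z w u hr hu := by
    have ha : (a : ℂˣ) = (b : ℂˣ)⁻¹ := by rw [eq_inv_of_mul_eq_one_left hab]; rfl
    rw [ha] at hu
    have := inv_commute (hf.psi_inv_mul _ _) (hf.psi_mul_inv _ _)
      (smul_commute_mul
        (hf.psi_xm i j z (w * ((b : ℂˣ) ^ 2)⁻¹) u hr (by rw [hu]; ext; push_cast; field_simp))
        (hf.psi_commute_psiInv i j z (w * (b : ℂˣ)⁻¹)))
    rw [mul_one] at this
    simp only [FunctionalAlgebra.antipodeGen, ← op_mul, ← op_smul, neg_mul, mul_neg, this, smul_neg]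
  xp_xm_same i z w hr := by
    have ha : (a : ℂˣ) = (b : ℂˣ)⁻¹ := by rw [eq_inv_of_mul_eq_one_left hab]; rfl
    have hx := hf.xp_xm_same i (z * ((b : ℂˣ) ^ 2)⁻¹) (w * ((b : ℂˣ) ^ 2)⁻¹)
      (by rwa [mul_div_mul_right_eq_div])
    have e₁ : ∀ y : ℂˣ, y * ((b : ℂˣ) ^ 2)⁻¹ * b = y * (b : ℂˣ)⁻¹ := fun y => by
      ext; push_cast; field_simp
    rw [mul_div_mul_right_eq_div, e₁, e₁] at hx
    -- Enclosing the commutator between φ⁻¹ and ψ⁻¹ turns its ψ-term into φ⁻¹ and its φ-term into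
    -- ψ⁻¹. The δ-arguments trade places as well, because a² = b⁻².
    have hx' := congrArg (fun y => f (.phiInv i (z * (b : ℂˣ)⁻¹)) * y *
      f (.psiInv i (w * (b : ℂˣ)⁻¹))) hx
    simp only [mul_sub, sub_mul, mul_smul_comm, smul_mul_assoc, hf.phi_inv_mul, one_mul] at hx'
    rw [mul_assoc _ (f (.psi i (w * (b : ℂˣ)⁻¹))), hf.psi_mul_inv, mul_one] at hx'
    simp only [FunctionalAlgebra.antipodeGen, ← op_mul, ← op_smul, ← op_sub, neg_mul, mul_neg,
      neg_neg, ha, inv_pow, inv_inv]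
    rw [hf.antipode_cross i i z w hr]
    congr 1
    simp only [mul_assoc] at hx' ⊢
    linear_combination (norm := module) -hx'
  xp_xm_ne i j z w hij hr := by
    simp only [FunctionalAlgebra.antipodeGen, ← op_mul, neg_mul, mul_neg, neg_neg]
    rw [hf.antipode_cross i j z w hr, ← hf.xp_xm_ne i j _ _ hij (by rwa [mul_div_mul_right_eq_div])]
    simp only [mul_assoc]
  xp_xp i j z w hr := by
    have hr' : g j i ((w / z : ℂˣ) : ℂ) = (g i j ((z / w : ℂˣ) : ℂ))⁻¹ := hg.inversion_div j i w z
    have := quadratic_mul_left hr (hf.phiInv_phiInv i j (z * (b : ℂˣ)⁻¹) (w * (b : ℂˣ)⁻¹))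
      (inv_commute (hf.phi_inv_mul _ _) (hf.phi_mul_inv _ _)
        (hf.phi_xp i j _ (w * ((b : ℂˣ) ^ 2)⁻¹) (z / w) hr (by ext; push_cast; field_simp)))
      (hr' ▸ inv_commute (hf.phi_inv_mul _ _) (hf.phi_mul_inv _ _)
        (hf.phi_xp j i _ (z * ((b : ℂˣ) ^ 2)⁻¹) (w / z) (hr' ▸ inv_ne_zero hr)
          (by ext; push_cast; field_simp)))
      (mul_div_mul_right_eq_div z w ((b : ℂˣ) ^ 2)⁻¹ ▸
        hf.xp_xp i j (z * ((b : ℂˣ) ^ 2)⁻¹) (w * ((b : ℂˣ) ^ 2)⁻¹)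
          (by rwa [mul_div_mul_right_eq_div]))
    simp only [FunctionalAlgebra.antipodeGen, ← op_mul, ← op_smul, neg_mul, mul_neg, neg_neg, this]
  xm_xm i j z w hr := by
    have hr' : g j i ((w / z : ℂˣ) : ℂ) = (g i j ((z / w : ℂˣ) : ℂ))⁻¹ := hg.inversion_div j i w z
    have hw := inv_commute' (hr' ▸ inv_ne_zero hr) (hf.psi_inv_mul _ _) (hf.psi_mul_inv _ _)
        (hf.psi_xm i j (z * (b : ℂˣ)⁻¹) (w * ((b : ℂˣ) ^ 2)⁻¹) (w / z) (hr' ▸ inv_ne_zero hr)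
          (by ext; push_cast; field_simp))
    rw [hr', inv_inv] at hw
    have := quadratic_mul_right hr (hf.psiInv_psiInv i j (z * (b : ℂˣ)⁻¹) (w * (b : ℂˣ)⁻¹))
      (inv_commute' hr (hf.psi_inv_mul _ _) (hf.psi_mul_inv _ _)
        (hf.psi_xm j i _ (z * ((b : ℂˣ) ^ 2)⁻¹) (z / w) hr (by ext; push_cast; field_simp))) hw
      (mul_div_mul_right_eq_div z w ((b : ℂˣ) ^ 2)⁻¹ ▸
        hf.xm_xm i j (z * ((b : ℂˣ) ^ 2)⁻¹) (w * ((b : ℂˣ) ^ 2)⁻¹)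
          (by rwa [mul_div_mul_right_eq_div]))
    simp only [FunctionalAlgebra.antipodeGen, ← op_mul, ← op_smul, neg_mul, mul_neg, neg_neg, this]

end Antipode

end FunctionalAlgebra

theorem HopfGroupCoalgebra.ext_of_maps {k : Type} [Field k] {G : Type} [Group G]
    {A : G → Type} [∀ a, Ring (A a)] [∀ a, Algebra k (A a)] {H H' : HopfGroupCoalgebra k G A}
    (h₁ : ∀ {a b c : G} (h : c = a * b), H.comul h = H'.comul h) (h₂ : H.counit = H'.counit)
    (h₃ : ∀ {a b : G} (h : a * b = 1), H.antipode h = H'.antipode h) : H = H' := by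
  cases H
  cases H'
  congr
  · funext a b c h
    exact h₁ h
  · funext a b h
    exact h₃ h

namespace FunctionalAlgebra

/-! ### Products twisted by an anti-homomorphism -/

section Convolution

variable {k A B : Type} [Field k] [Ring A] [Algebra k A] [Ring B] [Algebra k B]

/-- `M (S ⊗ id)` for an anti-homomorphism `S`. -/
noncomputable def mulLeftAnti (S : A →ₐ[k] Bᵐᵒᵖ) : A ⊗[k] B →ₗ[k] B :=
  LinearMap.mul' k B ∘ₗ TensorProduct.map
    ((MulOpposite.opLinearEquiv k).symm.toLinearMap ∘ₗ S.toLinearMap) LinearMap.id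

/-- `M (id ⊗ S)` for an anti-homomorphism `S`. -/
noncomputable def mulRightAnti (S : B →ₐ[k] Aᵐᵒᵖ) : A ⊗[k] B →ₗ[k] A :=
  LinearMap.mul' k A ∘ₗ TensorProduct.map LinearMap.id
    ((MulOpposite.opLinearEquiv k).symm.toLinearMap ∘ₗ S.toLinearMap)

@[simp]
theorem mulLeftAnti_tmul (S : A →ₐ[k] Bᵐᵒᵖ) (x : A) (y : B) :
    mulLeftAnti S (x ⊗ₜ y) = (S x).unop * y := rfl

@[simp]
theorem mulRightAnti_tmul (S : B →ₐ[k] Aᵐᵒᵖ) (x : A) (y : B) :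
    mulRightAnti S (x ⊗ₜ y) = x * (S y).unop := rfl

@[simp]
theorem mulLeftAnti_one (S : A →ₐ[k] Bᵐᵒᵖ) : mulLeftAnti S 1 = 1 := by
  simp [Algebra.TensorProduct.one_def]

@[simp]
theorem mulRightAnti_one (S : B →ₐ[k] Aᵐᵒᵖ) : mulRightAnti S 1 = 1 := by
  simp [Algebra.TensorProduct.one_def]

/-- Right multiplication by u ⊗ v sandwiches the value between S(u) and v; a scalar value can be
pulled out of the sandwich. -/
theorem mulLeftAnti_mul (S : A →ₐ[k] Bᵐᵒᵖ) {T : A ⊗[k] B} {r : k}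
    (hT : mulLeftAnti S T = algebraMap k B r) (T' : A ⊗[k] B) :
    mulLeftAnti S (T * T') = r • mulLeftAnti S T' := by
  induction T' with
  | zero => simp
  | add x y hx hy => rw [mul_add, map_add, hx, hy, map_add, smul_add]
  | tmul u v =>
    have : ∀ T : A ⊗[k] B, mulLeftAnti S (T * u ⊗ₜ v) = (S u).unop * mulLeftAnti S T * v := by
      intro T
      induction T with
      | zero => simp
      | add x y hx hy => rw [add_mul, map_add, hx, hy, map_add, mul_add, add_mul]
      | tmul x y => simp [mul_assoc]
    rw [this, hT, ← Algebra.commutes, mul_assoc, ← Algebra.smul_def, mulLeftAnti_tmul]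

/-- Mirror image: left multiplication sandwiches, so now the right-hand factor must have scalar
value. -/
theorem mulRightAnti_mul (S : B →ₐ[k] Aᵐᵒᵖ) {T' : A ⊗[k] B} {r : k}
    (hT : mulRightAnti S T' = algebraMap k A r) (T : A ⊗[k] B) :
    mulRightAnti S (T * T') = r • mulRightAnti S T := by
  induction T with
  | zero => simp
  | add x y hx hy => rw [add_mul, map_add, hx, hy, map_add, smul_add]
  | tmul u v =>
    have : ∀ T : A ⊗[k] B, mulRightAnti S (u ⊗ₜ v * T) = u * mulRightAnti S T * (S v).unop := by
      intro T
      induction T with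
      | zero => simp
      | add x y hx hy => rw [mul_add, map_add, hx, hy, map_add, mul_add, add_mul]
      | tmul x y => simp [mul_assoc]
    rw [this, hT, ← Algebra.commutes, mul_assoc, ← Algebra.smul_def, mulRightAnti_tmul]

end Convolution

/-! ### The Hopf structure and its uniqueness -/

section Hopf

variable {n : ℕ} {g : Fin (n - 1) → Fin (n - 1) → ℂ → ℂ} {q : ℂ} {δ : ℂˣ → ℂ}
  {Γ : Subgroup ℂˣ}

theorem U.induction {t : Γ} {P : U g q δ Γ t → Prop}
    (scalar : ∀ r : ℂ, P (algebraMap ℂ _ r)) (gen : ∀ x, P (gen g q δ Γ t x))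
    (mul : ∀ x y, P x → P y → P (x * y)) (add : ∀ x y, P x → P y → P (x + y))
    (y : U g q δ Γ t) : P y := by
  obtain ⟨p, rfl⟩ := mk_surjective t y
  induction p using FreeAlgebra.induction ℂ (Gen n) with
  | grade0 r => rw [AlgHom.commutes]; exact scalar r
  | grade1 x => exact gen x
  | mul x y hx hy => rw [map_mul]; exact mul _ _ hx hy
  | add x y hx hy => rw [map_add]; exact add _ _ hx hy

/-- Reduces an antipode law to generators: the induction hypothesis for the first factor says
precisely that its value is a scalar, as `mulLeftAnti_mul` demands. -/
theorem mulLeftAnti_eq_counit {A B : Type} [Ring A] [Algebra ℂ A] [Ring B] [Algebra ℂ B] {t : Γ}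
    (D : U g q δ Γ t →ₐ[ℂ] A ⊗[ℂ] B) (ε : U g q δ Γ t →ₐ[ℂ] ℂ) (S : A →ₐ[ℂ] Bᵐᵒᵖ)
    (h : ∀ x, mulLeftAnti S (D (gen g q δ Γ t x)) = algebraMap ℂ B (ε (gen g q δ Γ t x)))
    (y : U g q δ Γ t) : mulLeftAnti S (D y) = algebraMap ℂ B (ε y) := by
  induction y using U.induction with
  | scalar r =>
    simp [Algebra.algebraMap_eq_smul_one]
  | gen x => exact h x
  | mul x y hx hy =>
    rw [map_mul, mulLeftAnti_mul S hx, hy, map_mul, map_mul, Algebra.smul_def]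
  | add x y hx hy => simp only [map_add, hx, hy]

theorem mulRightAnti_eq_counit {A B : Type} [Ring A] [Algebra ℂ A] [Ring B] [Algebra ℂ B] {t : Γ}
    (D : U g q δ Γ t →ₐ[ℂ] A ⊗[ℂ] B) (ε : U g q δ Γ t →ₐ[ℂ] ℂ) (S : B →ₐ[ℂ] Aᵐᵒᵖ)
    (h : ∀ x, mulRightAnti S (D (gen g q δ Γ t x)) = algebraMap ℂ A (ε (gen g q δ Γ t x)))
    (y : U g q δ Γ t) : mulRightAnti S (D y) = algebraMap ℂ A (ε y) := by
  induction y using U.induction with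
  | scalar r =>
    simp [Algebra.algebraMap_eq_smul_one]
  | gen x => exact h x
  | mul x y hx hy =>
    rw [map_mul, mulRightAnti_mul S hy, hx, map_mul, mul_comm, map_mul, Algebra.smul_def]
  | add x y hx hy => simp only [map_add, hx, hy]

/-- The coproduct. -/
noncomputable def comulHom (q : ℂ) (δ : ℂˣ → ℂ) (hg : IsStructureFunctions n g) {a b c : Γ}
    (hc : c = a * b) : U g q δ Γ c →ₐ[ℂ] U g q δ Γ a ⊗[ℂ] U g q δ Γ b :=
  ((isRep_gen a).comulGen hg hc (isRep_gen b)).lift hg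

/-- The counit. -/
noncomputable def counitHom (q : ℂ) (δ : ℂˣ → ℂ) (Γ : Subgroup ℂˣ)
    (hg : IsStructureFunctions n g) : U g q δ Γ 1 →ₐ[ℂ] ℂ :=
  IsRep.lift hg (t := 1) isRep_counitGen

/-- The antipode. -/
noncomputable def antipodeHom (q : ℂ) (δ : ℂˣ → ℂ) (hg : IsStructureFunctions n g) {a b : Γ}
    (hab : a * b = 1) : U g q δ Γ a →ₐ[ℂ] (U g q δ Γ b)ᵐᵒᵖ :=
  ((isRep_gen b).antipodeGen hg hab).lift hg

section Values

variable (hg : IsStructureFunctions n g)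

@[simp]
theorem comulHom_gen {a b c : Γ} (hc : c = a * b) (x : Gen n) :
    comulHom q δ hg hc (gen g q δ Γ c x) =
      comulGen (a : ℂˣ) (b : ℂˣ) (gen g q δ Γ a) (gen g q δ Γ b) x :=
  IsRep.lift_gen _ _ _

@[simp]
theorem counitHom_gen (x : Gen n) : counitHom q δ Γ hg (gen g q δ Γ 1 x) = counitGen x :=
  IsRep.lift_gen _ _ _

@[simp]
theorem antipodeHom_gen {a b : Γ} (hab : a * b = 1) (x : Gen n) :
    antipodeHom q δ hg hab (gen g q δ Γ a x) =
      MulOpposite.op (antipodeGen (b : ℂˣ) (gen g q δ Γ b) x) :=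
  IsRep.lift_gen _ _ _

/-- The Hopf structure. -/
noncomputable def hopf (q : ℂ) (δ : ℂˣ → ℂ) (Γ : Subgroup ℂˣ) (hg : IsStructureFunctions n g) :
    HopfGroupCoalgebra ℂ Γ (U g q δ Γ) where
  comul := comulHom q δ hg
  counit := counitHom q δ Γ hg
  antipode := antipodeHom q δ hg
  coassoc {a b c ab bc abc} h₁ h₂ h₃ h₄ y := by
    subst h₁ h₃
    have : ((Algebra.TensorProduct.assoc ℂ ℂ ℂ (U g q δ Γ a) (U g q δ Γ b)
        (U g q δ Γ c)).toAlgHom.comp (Algebra.TensorProduct.map (comulHom q δ hg rfl)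
        (AlgHom.id ℂ (U g q δ Γ c)))).comp (comulHom q δ hg h₂) =
        (Algebra.TensorProduct.map (AlgHom.id ℂ (U g q δ Γ a)) (comulHom q δ hg rfl)).comp
          (comulHom q δ hg h₄) := by
      refine U.algHom_ext fun x => ?_
      have hab : ∀ z : ℂˣ, z * ((a : ℂˣ) * b) * (b : ℂˣ)⁻¹ = z * a := fun z => by
        rw [← mul_assoc, mul_inv_cancel_right]
      have hbc : ∀ z : ℂˣ, z * ((b : ℂˣ) * c) * (b : ℂˣ)⁻¹ = z * c := fun z => by
        rw [mul_comm (b : ℂˣ), ← mul_assoc, mul_inv_cancel_right]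
      cases x <;>
        simp [comulGen, TensorProduct.add_tmul, TensorProduct.tmul_add,
          Algebra.TensorProduct.one_def, mul_pow, hab, hbc, add_assoc] <;>
        -- After expansion both sides have the same summands, up to the order of the factors in the
        -- spectral points.
        simp only [pow_two, @mul_assoc ℂˣ, @mul_comm ℂˣ, @mul_left_comm ℂˣ]
    exact DFunLike.congr_fun this y
  counit_left {a} h y := by
    have : ((Algebra.TensorProduct.lid ℂ (U g q δ Γ a)).toAlgHom.comp
        (Algebra.TensorProduct.map (counitHom q δ Γ hg) (AlgHom.id ℂ (U g q δ Γ a)))).comp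
        (comulHom q δ hg h) = AlgHom.id ℂ _ := by
      refine U.algHom_ext fun x => ?_
      cases x <;> simp [comulGen, counitGen]
    exact DFunLike.congr_fun this y
  counit_right {a} h y := by
    have : ((Algebra.TensorProduct.rid ℂ ℂ (U g q δ Γ a)).toAlgHom.comp
        (Algebra.TensorProduct.map (AlgHom.id ℂ (U g q δ Γ a)) (counitHom q δ Γ hg))).comp
        (comulHom q δ hg h) = AlgHom.id ℂ _ := by
      refine U.algHom_ext fun x => ?_
      cases x <;> simp [comulGen, counitGen]
    exact DFunLike.congr_fun this y
  antipode_left {a b} h h' y := by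
    refine mulLeftAnti_eq_counit (comulHom q δ hg h') (counitHom q δ Γ hg) (antipodeHom q δ hg h)
      (fun x => ?_) y
    have hb := isRep_gen (g := g) (q := q) (δ := δ) b
    have ha : (a : ℂˣ) = (b : ℂˣ)⁻¹ := by rw [eq_inv_of_mul_eq_one_left h]; rfl
    have hb' : (b : ℂˣ) ^ 2 * (b : ℂˣ)⁻¹ = b := by rw [pow_two, mul_inv_cancel_right]
    -- For x⁺(z) the two terms are −φ(zb⁻¹)⁻¹x⁺(zb⁻²) and φ(za)⁻¹x⁺(za²), which cancel as a = b⁻¹.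
    cases x <;> simp [comulGen, counitGen, antipodeGen, ha, hb.phi_mul_inv, hb.phi_inv_mul,
      hb.psi_mul_inv, hb.psi_inv_mul, mul_assoc, hb']
  antipode_right {a b} h h' y := by
    refine mulRightAnti_eq_counit (comulHom q δ hg h') (counitHom q δ Γ hg)
      (antipodeHom q δ hg h) (fun x => ?_) y
    have hr := isRep_gen (g := g) (q := q) (δ := δ) a
    have hb : (b : ℂˣ) = (a : ℂˣ)⁻¹ := by rw [eq_inv_of_mul_eq_one_left h]; rfl
    have ha' : (a : ℂˣ) ^ 2 * (a : ℂˣ)⁻¹ = a := by rw [pow_two, mul_inv_cancel_right]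
    have hphi : ∀ (i : Fin (n - 1)) (z : ℂˣ) (y : U g q δ Γ a),
        gen g q δ Γ a (.phi i z) * (gen g q δ Γ a (.phiInv i z) * y) = y := fun i z y => by
      rw [← mul_assoc, hr.phi_mul_inv, one_mul]
    cases x <;> simp [comulGen, counitGen, antipodeGen, hb, hr.phi_mul_inv, hr.phi_inv_mul,
      hr.psi_mul_inv, hr.psi_inv_mul, mul_assoc, ha', hphi]

theorem comulFormulas_hopf : ComulFormulas (hopf q δ Γ hg) where
  on_qc {a b c} hc := by
    rw [qc, AlgHom.commutes]
    simp only [qc, Algebra.algebraMap_eq_smul_one, Algebra.TensorProduct.one_def,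
      ← TensorProduct.smul_tmul', TensorProduct.tmul_smul, smul_smul]
    congr 1
    rw [hc]
    push_cast
    ring
  on_xp hc i z := comulHom_gen hg hc (.xp i z)
  on_xm hc i z := comulHom_gen hg hc (.xm i z)
  on_phi hc i z := comulHom_gen hg hc (.phi i z)
  on_psi hc i z := comulHom_gen hg hc (.psi i z)

theorem counitFormulas_hopf : CounitFormulas (hopf q δ Γ hg) where
  on_qc := by simp [qc]
  on_xp i z := counitHom_gen hg (.xp i z)
  on_xm i z := counitHom_gen hg (.xm i z)
  on_phi i z := counitHom_gen hg (.phi i z)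
  on_psi i z := counitHom_gen hg (.psi i z)

theorem antipodeFormulas_hopf : AntipodeFormulas (hopf q δ Γ hg) where
  on_qc {a b} hab := by
    have ha : (a : ℂˣ) = (b : ℂˣ)⁻¹ := by rw [eq_inv_of_mul_eq_one_left hab]; rfl
    rw [qc, AlgHom.commutes, ha, Units.val_inv_eq_inv_val, inv_pow]
    rfl
  on_xp hab i z := congrArg MulOpposite.unop (antipodeHom_gen hg hab (.xp i z))
  on_xm hab i z := congrArg MulOpposite.unop (antipodeHom_gen hg hab (.xm i z))
  on_phi hab i z := congrArg MulOpposite.unop (antipodeHom_gen hg hab (.phi i z))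
  on_psi hab i z := congrArg MulOpposite.unop (antipodeHom_gen hg hab (.psi i z))

end Values

/-- Homomorphisms agree if they agree on the currents. -/
theorem U.algHom_ext_currents {t : Γ} {A : Type} [Ring A] [Algebra ℂ A]
    {F G : U g q δ Γ t →ₐ[ℂ] A}
    (hxp : ∀ i z, F (xp g q δ Γ i z) = G (xp g q δ Γ i z))
    (hxm : ∀ i z, F (xm g q δ Γ i z) = G (xm g q δ Γ i z))
    (hphi : ∀ i z, F (phi g q δ Γ i z) = G (phi g q δ Γ i z))
    (hpsi : ∀ i z, F (psi g q δ Γ i z) = G (psi g q δ Γ i z)) : F = G := by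
  have ht := isRep_gen (g := g) (q := q) (δ := δ) t
  refine U.algHom_ext fun x => ?_
  cases x with
  | xp i z => exact hxp i z
  | xm i z => exact hxm i z
  | phi i z => exact hphi i z
  | psi i z => exact hpsi i z
  | phiInv i z =>
    -- The images of φ⁻¹ under `F` and `G` are a left and a right inverse of the same element.
    refine left_inv_eq_right_inv (a := F (gen g q δ Γ t (.phi i z))) ?_ ?_
    · rw [← map_mul, ht.phi_inv_mul, map_one]
    · rw [show F (gen g q δ Γ t (.phi i z)) = G (gen g q δ Γ t (.phi i z)) from hphi i z,
        ← map_mul, ht.phi_mul_inv, map_one]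
  | psiInv i z =>
    refine left_inv_eq_right_inv (a := F (gen g q δ Γ t (.psi i z))) ?_ ?_
    · rw [← map_mul, ht.psi_inv_mul, map_one]
    · rw [show F (gen g q δ Γ t (.psi i z)) = G (gen g q δ Γ t (.psi i z)) from hpsi i z,
        ← map_mul, ht.psi_mul_inv, map_one]

theorem hopf_unique {H H' : HopfGroupCoalgebra ℂ Γ (U g q δ Γ)}
    (h₁ : ComulFormulas H) (h₂ : CounitFormulas H) (h₃ : AntipodeFormulas H)
    (h₁' : ComulFormulas H') (h₂' : CounitFormulas H') (h₃' : AntipodeFormulas H') : H = H' := by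
  refine HopfGroupCoalgebra.ext_of_maps (fun h => U.algHom_ext_currents ?_ ?_ ?_ ?_)
    (U.algHom_ext_currents ?_ ?_ ?_ ?_) (fun h => U.algHom_ext_currents ?_ ?_ ?_ ?_) <;> intro i z
  · rw [h₁.on_xp, h₁'.on_xp]
  · rw [h₁.on_xm, h₁'.on_xm]
  · rw [h₁.on_phi, h₁'.on_phi]
  · rw [h₁.on_psi, h₁'.on_psi]
  · rw [h₂.on_xp, h₂'.on_xp]
  · rw [h₂.on_xm, h₂'.on_xm]
  · rw [h₂.on_phi, h₂'.on_phi]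
  · rw [h₂.on_psi, h₂'.on_psi]
  · exact MulOpposite.unop_injective (by rw [h₃.on_xp, h₃'.on_xp])
  · exact MulOpposite.unop_injective (by rw [h₃.on_xm, h₃'.on_xm])
  · exact MulOpposite.unop_injective (by rw [h₃.on_phi, h₃'.on_phi])
  · exact MulOpposite.unop_injective (by rw [h₃.on_psi, h₃'.on_psi])

end Hopf

end FunctionalAlgebra

theorem theorem2p1 (n : ℕ) (g : Fin (n - 1) → Fin (n - 1) → ℂ → ℂ)
    (hg : FunctionalAlgebra.IsStructureFunctions n g)
    (q : ℂ) (hq : q ≠ 0) (hq' : q - q⁻¹ ≠ 0)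
    (δ : ℂˣ → ℂ) (hδ : Function.support δ ⊆ {1})
    (Γ : Subgroup ℂˣ) :
    ∃! H : HopfGroupCoalgebra ℂ Γ (FunctionalAlgebra.U g q δ Γ),
      FunctionalAlgebra.ComulFormulas H ∧ FunctionalAlgebra.CounitFormulas H ∧
        FunctionalAlgebra.AntipodeFormulas H :=
  ⟨FunctionalAlgebra.hopf q δ Γ hg, ⟨FunctionalAlgebra.comulFormulas_hopf hg,
    FunctionalAlgebra.counitFormulas_hopf hg, FunctionalAlgebra.antipodeFormulas_hopf hg⟩,
    fun _ hH => FunctionalAlgebra.hopf_unique hH.1 hH.2.1 hH.2.2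
      (FunctionalAlgebra.comulFormulas_hopf hg) (FunctionalAlgebra.counitFormulas_hopf hg)
      (FunctionalAlgebra.antipodeFormulas_hopf hg)⟩
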